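/- Let $V$ be a finite set of parties with finite-dimensional Hilbert spaces. Let $\sigma=|\psi\rangle\langle\psi|$ be a pure state of these parties, and let $S_1,S_2,S_4$ be operators, each of them unitary or an orthogonal projection, such that $S_1S_2=S_2S_1$ and $S_i|\psi\rangle=|\psi\rangle$ for $i=1,2,4$. Put $S_3=S_1S_2$. Assume: 1. $V$ is the disjoint union of four groups $G_1,G_2,G_3,G_4$ such that, for $i=1,2,3,4$, $S_i$ has no support in $G_i$, i.e. $S_i$ is the tensor product of the identity on the parties in $G_i$ and an operator on the other parties. 2. Add to the system a copy $G_1'$ of the parties in $G_1$. Let $S_{4'}$ be the operator which acts as $S_4$, but with $G_1'$ in place of $G_1$ (so it acts on $G_1',G_2,G_3$, and as the identity on $G_1$ and $G_4$), and extend $S_3$ by the identity on $G_1'$. Then $S_3$ and $S_{4'}$ have no common eigenvector with eigenvalue $+1$. A bipartite network is given by a finite collection of sources, each of which sends quantum systems to at most two of the parties (several sources may serve the same parties). A state $\varrho$ can be prepared in the network if $$\varrho=\sum_{l}p_l\Big(\bigotimes_{v\in V}\mathcal E_v^{(l)}\Big)\Big[\bigotimes_{e}\varsigma_e\Big]$$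 with finite-dimensional states $\varsigma_e$ of the sources $e$, a discrete probability distribution $(p_l)$ (shared randomness), and local channels $\mathcal E_v^{(l)}$, where $\mathcal E_v^{(l)}$ acts on the systems received by the party $v$. Then $\sigma$ cannot be prepared in any bipartite network. Moreover, for every state $\varrho$ that can be prepared in a bipartite network, the fidelity $f=\langle\psi|\varrho|\psi\rangle$ satisfies $$f\le\frac{7+\sqrt{4+5\lambda'/2}}{10},$$ where $\lambda'=\max_{\|\varphi\|=1}|\langle\varphi|T|\varphi\rangle|$ is the largest absolute expectation value (the numerical radius) of the anticommutator $T=\{S_3,S_{4'}^\dagger\}=S_3S_{4'}^\dagger+S_{4'}^\dagger S_3$. If $T$ is normal (for instance if the $S_i$ are projections, or if $S_3$ and $S_{4'}$ are unitaries which commute up to a phase), then the bound also holds with $\lambda'$ the largest absolute value of an eigenvalue of $T$. -/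

import Mathlib

open Matrix
open scoped ComplexOrder

noncomputable section

/-! Finite-dimensional multiparty systems. A party `v` has the Hilbert space `ℂ ^ (ι v)`, the joint
system of the parties `V` has the computational basis `(v : V) → ι v`, and operators on it are
square complex matrices indexed by this basis. -/

/-- `ρ` is a density matrix. -/
def IsDensityMatrix {n : Type*} [Fintype n] (ρ : Matrix n n ℂ) : Prop :=
  ρ.PosSemidef ∧ ρ.trace = 1

/-- A quantum channel (completely positive trace-preserving map) from the system with basis `a` to
the system with basis `b`, in Kraus form: `X ↦ ∑ k, K k * X * (K k)ᴴ`. -/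
structure QuantumChannel (a b : Type*) [Fintype a] [DecidableEq a] [Fintype b] where
  rank : ℕ
  kraus : Fin rank → Matrix b a ℂ
  trace_preserving : ∑ k, (kraus k)ᴴ * kraus k = 1

/-- A network: a finite hypergraph whose vertices are the parties; every hyperedge is a source,
which sends particles to the parties that it contains. Several sources may serve the same set
of parties. -/
structure QuantumNetwork (V : Type*) where
  Source : Type
  [fintypeSource : Fintype Source]
  [decEqSource : DecidableEq Source]
  parties : Source → Finset V

attribute [instance] QuantumNetwork.fintypeSource QuantumNetwork.decEqSource

namespace QuantumNetwork

variable {V : Type*} [Fintype V] [DecidableEq V]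

/-- All the sources are (at most) bipartite. -/
def IsBipartite (N : QuantumNetwork V) : Prop :=
  ∀ e, (N.parties e).card ≤ 2

/-- Basis of the joint system of the particles emitted by the source `e`: one particle, of
dimension `dim e v`, for each party `v` of `e`. -/
abbrev Emitted (N : QuantumNetwork V) (dim : N.Source → V → ℕ) (e : N.Source) : Type _ :=
  (v : {v : V // v ∈ N.parties e}) → Fin (dim e v.1)

/-- Basis of the joint system of the particles received by the party `v`. -/
abbrev Received (N : QuantumNetwork V) (dim : N.Source → V → ℕ) (v : V) : Type :=
  (e : {e : N.Source // v ∈ N.parties e}) → Fin (dim e.1 v)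

/-- Basis of the joint system of all the particles of the network. -/
abbrev Particles (N : QuantumNetwork V) (dim : N.Source → V → ℕ) : Type _ :=
  (e : N.Source) → N.Emitted dim e

/-- The particles received by the party `v`, among all the particles. -/
def received (N : QuantumNetwork V) {dim : N.Source → V → ℕ} (v : V) (x : N.Particles dim) :
    N.Received dim v :=
  fun e => x e.1 ⟨v, e.2⟩

/-- The tensor product of the states of the sources. -/
def sourceState (N : QuantumNetwork V) {dim : N.Source → V → ℕ}
    (ς : (e : N.Source) → Matrix (N.Emitted dim e) (N.Emitted dim e) ℂ) :
    Matrix (N.Particles dim) (N.Particles dim) ℂ :=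
  fun x y => ∏ e, ς e (x e) (y e)

variable {ι : V → Type*} [∀ v, Fintype (ι v)] [∀ v, DecidableEq (ι v)]

/-- The tensor product over the parties `v` of the local operators `K v`. -/
def tensorLocal (N : QuantumNetwork V) {dim : N.Source → V → ℕ}
    (K : (v : V) → Matrix (ι v) (N.Received dim v) ℂ) :
    Matrix ((v : V) → ι v) (N.Particles dim) ℂ :=
  fun i x => ∏ v, K v (i v) (N.received v x)

/-- `(⨂ v, E v) (X)`: the tensor product of the local channels `E v`, applied to `X`. Its Kraus
operators are the tensor products of the local Kraus operators. -/
def applyLocal (N : QuantumNetwork V) {dim : N.Source → V → ℕ}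
    (E : (v : V) → QuantumChannel (N.Received dim v) (ι v))
    (X : Matrix (N.Particles dim) (N.Particles dim) ℂ) :
    Matrix ((v : V) → ι v) ((v : V) → ι v) ℂ :=
  ∑ k : (v : V) → Fin (E v).rank,
    N.tensorLocal (fun v => (E v).kraus (k v)) * X *
      (N.tensorLocal (fun v => (E v).kraus (k v)))ᴴ

/-- `ρ` can be prepared in the correlated quantum network `N`:
`ρ = ∑ l, p l • (⨂ v, E l v) (⨂ e, ς e)` for some source states `ς e` of finite dimension, some
(finite or countably infinite) shared randomness `l` with probabilities `p l`, and local channels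
`E l v` which may depend on `l`. -/
def CanPrepare (N : QuantumNetwork V) (ρ : Matrix ((v : V) → ι v) ((v : V) → ι v) ℂ) : Prop :=
  ∃ (dim : N.Source → V → ℕ)
    (ς : (e : N.Source) → Matrix (N.Emitted dim e) (N.Emitted dim e) ℂ)
    (L : Type) (p : L → ℝ)
    (E : L → (v : V) → QuantumChannel (N.Received dim v) (ι v)),
    (∀ e, IsDensityMatrix (ς e)) ∧ (∀ l, 0 ≤ p l) ∧ HasSum p 1 ∧
    ∀ i j, HasSum (fun l => (p l : ℂ) * N.applyLocal (E l) (N.sourceState ς) i j) (ρ i j)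

end QuantumNetwork

/-- The projector `|ψ⟩⟨ψ|`. -/
def pureState {n : Type*} (ψ : n → ℂ) : Matrix n n ℂ :=
  vecMulVec ψ (star ψ)

/-- The fidelity `⟨ψ|ρ|ψ⟩` of the pure state `|ψ⟩⟨ψ|` with the state `ρ`. -/
def pureFidelity {n : Type*} [Fintype n] (ψ : n → ℂ) (ρ : Matrix n n ℂ) : ℝ :=
  (star ψ ⬝ᵥ ρ *ᵥ ψ).re

/-- `S` is a unitary operator or an orthogonal projection. -/
def IsUnitaryOrProjection {n : Type*} [Fintype n] [DecidableEq n] (S : Matrix n n ℂ) : Prop :=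
  S ∈ unitary (Matrix n n ℂ) ∨ (S.IsHermitian ∧ S * S = S)

section Support

variable {V : Type*} [Fintype V] [DecidableEq V]
  {ι : V → Type*} [∀ v, Fintype (ι v)] [∀ v, DecidableEq (ι v)]

/-- `S` has no support in the set `G` of parties: it is the tensor product of the identity on the
parties in `G` and of an operator `R` on the other parties. -/
def NoSupportIn (S : Matrix ((v : V) → ι v) ((v : V) → ι v) ℂ) (G : Finset V) : Prop :=
  ∃ R : Matrix ((v : {v : V // v ∉ G}) → ι v.1) ((v : {v : V // v ∉ G}) → ι v.1) ℂ,
    ∀ x y, S x y =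
      (if ∀ v ∈ G, x v = y v then 1 else 0) * R (fun v => x v.1) (fun v => y v.1)

/-- Basis of the joint system of all the parties together with a copy of the parties in `G`. -/
abbrev WithCopy (ι : V → Type*) (G : Finset V) : Type _ :=
  ((v : V) → ι v) × ((v : {v : V // v ∈ G}) → ι v.1)

/-- The operator `S` on the original parties, extended by the identity on the copy of `G`. -/
def onOriginal (G : Finset V) (S : Matrix ((v : V) → ι v) ((v : V) → ι v) ℂ) :
    Matrix (WithCopy ι G) (WithCopy ι G) ℂ :=
  fun x y => S x.1 y.1 * (if x.2 = y.2 then 1 else 0)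

/-- The configuration of the copy of `G` and of the original parties outside `G`. -/
def swapIn (G : Finset V) (x : WithCopy ι G) : (v : V) → ι v :=
  fun v => if h : v ∈ G then x.2 ⟨v, h⟩ else x.1 v

/-- The operator which acts as `S` on the copy of `G` and the original parties outside `G`, and as
the identity on the original parties in `G`. -/
def onCopy (G : Finset V) (S : Matrix ((v : V) → ι v) ((v : V) → ι v) ℂ) :
    Matrix (WithCopy ι G) (WithCopy ι G) ℂ :=
  fun x y => S (swapIn G x) (swapIn G y) * (if ∀ v ∈ G, x.1 v = y.1 v then 1 else 0)

end Support

/-- The anticommutator `{A, B}`. -/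
def anticommutator {n : Type*} [Fintype n] (A B : Matrix n n ℂ) : Matrix n n ℂ :=
  A * B + B * A

/-- The largest absolute value of an expectation value `⟨φ|T|φ⟩`, `φ` a unit vector (the numerical
radius of `T`). For normal `T` it is the largest absolute value of an eigenvalue. -/
def maxAbsExpectation {n : Type*} [Fintype n] (T : Matrix n n ℂ) : ℝ :=
  sSup {r : ℝ | ∃ φ : n → ℂ, star φ ⬝ᵥ φ = 1 ∧ r = ‖star φ ⬝ᵥ T *ᵥ φ‖}

/-- The largest absolute value of an eigenvalue of `T`. -/
def maxAbsEigenvalue {n : Type*} [Fintype n] [DecidableEq n] (T : Matrix n n ℂ) : ℝ :=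
  sSup {r : ℝ | ∃ μ : ℂ, Module.End.HasEigenvalue (Matrix.toLin' T) μ ∧ r = ‖μ‖}

end

/-!
Let `f` be the fidelity with `ψ` of a state `ρ` prepared in a bipartite network, first without
shared randomness. From the same sources and local channels other states can be prepared
(inflations), which share some of the marginals of `ρ`.

* In `η`, the sources between `G₁` and `G₂` are cut, i.e. `G₁` and `G₂` receive particles from
  independent copies of such a source. The marginals of `η` and of `ρ` agree off `G₁` and off `G₂`,
  so `S₁` and `S₂` cannot tell `η` from `ρ`. The projections onto the fixed vectors of `S₁` and of
  `S₂` commute and have expectation at least `f`, so by a union bound their product has expectation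
  at least `2 f - 1` in `η`. As `S₁ S₂` is the identity on its range, the real part of `⟨S₁ S₂⟩` is
  at least `4 f - 3` in `η`.
* In `ξ`, the sources between `G₁` and `G₄` serve the original of `G₁`, and the sources between `G₁`
  and `G₂` or `G₃` serve the copy of `G₁`. Off `G₃`, where `S₃ = S₁ S₂` acts, the original parties
  have the same marginal as in `η`; off `G₄`, the parties with the copy of `G₁` in place of `G₁`
  have the same marginal as in `ρ`. Hence `Re ⟨S₃⟩ ≥ 4 f - 3` and `Re ⟨S₄'⟩ ≥ 2 f - 1` in `ξ`
  (`QuantumNetwork.exists_inflation_expectation_le`).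

If `f = 1`, then `S₃` and `S₄'` fix the support of `ξ`, which contradicts the assumption on common
eigenvectors (`exists_common_fixed_vector`). In general, put `X = Re ⟨S₃⟩` and `Y = Re ⟨S₄'⟩`. The
variances of `X S₃ + Y S₄'` and of its adjoint are nonnegative, so that
`(X² + Y²)² ≤ X² + Y² + X Y Re ⟨T⟩` (`sq_sq_add_sq_le`), and therefore `X² + Y² ≤ 1 + λ' / 2` when
`f > 9 / 10`, which gives the bound on `f`; for `f ≤ 9 / 10` the bound is trivial. Shared randomness
is dealt with by averaging over its values.

Both inflations are obtained from one construction, `QuantumNetwork.twoCopyState`: take two complete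
copies of the network and exchange, between the copies, the particles from `e` to the parties in
`W e`, for each source `e`. An observable of the first copy without support in `G` does not detect an
exchange of particles at the parties in `G`, because the channels there are trace preserving; and
exchanging all the particles of a source has no effect at all
(`QuantumNetwork.trace_kronecker_one_mul_twoCopyState_congr`). All the equalities of marginals
follow from these two facts, since a bipartite source which reaches a party in `G` reaches at most
one party outside `G`.
-/

noncomputable section

/-! ### Expectation values in a state -/

section Expectation

variable {n : Type*} [Fintype n]

lemma trace_conjTranspose_mul_of_isHermitian {A ρ : Matrix n n ℂ} (hρ : ρ.IsHermitian) :
    (Aᴴ * ρ).trace = star (A * ρ).trace := by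
  rw [← Matrix.trace_conjTranspose, Matrix.conjTranspose_mul, hρ.eq, Matrix.trace_mul_comm]

lemma re_trace_conjTranspose_mul {A ρ : Matrix n n ℂ} (hρ : ρ.IsHermitian) :
    (Aᴴ * ρ).trace.re = (A * ρ).trace.re := by
  rw [trace_conjTranspose_mul_of_isHermitian hρ]; simp

variable [DecidableEq n]

lemma Matrix.PosSemidef.trace_mul_nonneg {A ρ : Matrix n n ℂ} (hA : A.PosSemidef)
    (hρ : ρ.PosSemidef) : 0 ≤ (A * ρ).trace := by
  obtain ⟨B, rfl⟩ : ∃ B : Matrix n n ℂ, ρ = Bᴴ * B := by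
    open scoped MatrixOrder Matrix.Norms.L2Operator in
    exact CStarAlgebra.nonneg_iff_eq_star_mul_self.mp hρ.nonneg
  rw [← Matrix.mul_assoc, Matrix.trace_mul_comm, ← Matrix.mul_assoc]
  exact (hA.mul_mul_conjTranspose_same B).trace_nonneg

lemma re_trace_mul_nonneg {A ρ : Matrix n n ℂ} (hA : A.PosSemidef) (hρ : IsDensityMatrix ρ) :
    0 ≤ (A * ρ).trace.re :=
  (Complex.le_def.1 (hA.trace_mul_nonneg hρ.1)).1

/-- `A` and its adjoint have operator norm at most `1`. -/
structure IsContraction (A : Matrix n n ℂ) : Prop where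
  posSemidef : (1 - Aᴴ * A).PosSemidef
  posSemidef_adjoint : (1 - A * Aᴴ).PosSemidef

lemma IsContraction.mul {A B : Matrix n n ℂ} (hA : IsContraction A) (hB : IsContraction B) :
    IsContraction (A * B) := by
  constructor
  · convert hB.1.add (hA.1.conjTranspose_mul_mul_same B) using 1
    rw [Matrix.conjTranspose_mul]; noncomm_ring
  · convert hA.2.add (hB.2.mul_mul_conjTranspose_same A) using 1
    rw [Matrix.conjTranspose_mul]; noncomm_ring

lemma IsUnitaryOrProjection.isContraction {S : Matrix n n ℂ} (hS : IsUnitaryOrProjection S) :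
    IsContraction S := by
  rcases hS with h | ⟨h, h'⟩
  · have h1 : Sᴴ * S = 1 := (Unitary.mem_iff.1 h).1
    have h2 : S * Sᴴ = 1 := (Unitary.mem_iff.1 h).2
    constructor
    · rw [h1, sub_self]; exact .zero
    · rw [h2, sub_self]; exact .zero
  · have key : (1 - S).PosSemidef := by
      have e : (1 - S)ᴴ * (1 - S) = 1 - S := by
        rw [Matrix.conjTranspose_sub, Matrix.conjTranspose_one, h.eq]
        exact IsIdempotentElem.one_sub h'
      rw [← e]; exact posSemidef_conjTranspose_mul_self _
    constructor <;> rwa [h.eq, h']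

lemma IsUnitaryOrProjection.isStarNormal {S : Matrix n n ℂ} (hS : IsUnitaryOrProjection S) :
    Sᴴ * S = S * Sᴴ := by
  rcases hS with h | ⟨h, h'⟩
  · exact (Unitary.mem_iff.1 h).1.trans (Unitary.mem_iff.1 h).2.symm
  · rw [h.eq]

lemma IsUnitaryOrProjection.conjTranspose_mulVec {S : Matrix n n ℂ}
    (hS : IsUnitaryOrProjection S) {ψ : n → ℂ} (h : S *ᵥ ψ = ψ) : Sᴴ *ᵥ ψ = ψ := by
  rcases hS with h' | ⟨h', -⟩
  · have h1 : Sᴴ * S = 1 := (Unitary.mem_iff.1 h').1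
    conv_lhs => rw [← h, Matrix.mulVec_mulVec, h1, Matrix.one_mulVec]
  · rw [h'.eq, h]

/-- A union bound: two commuting orthogonal projections which occur with probabilities `a`, `b`
occur together with probability at least `a + b - 1`. -/
lemma re_trace_mul_add_le {P Q ρ : Matrix n n ℂ} (hP : P.IsHermitian) (hP' : P * P = P)
    (hQ : Q.IsHermitian) (hQ' : Q * Q = Q) (hPQ : P * Q = Q * P) (hρ : IsDensityMatrix ρ) :
    (P * ρ).trace.re + (Q * ρ).trace.re - 1 ≤ (P * Q * ρ).trace.re := by
  have e : ((1 - P) * (1 - Q))ᴴ * ((1 - P) * (1 - Q)) = 1 - P - Q + P * Q := by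
    have eP : (1 - P) * (1 - P) = 1 - P := IsIdempotentElem.one_sub hP'
    have eQ : (1 - Q) * (1 - Q) = 1 - Q := IsIdempotentElem.one_sub hQ'
    have c : (1 - P) * (1 - Q) = (1 - Q) * (1 - P) := by
      simp only [Matrix.mul_sub, Matrix.sub_mul, hPQ, Matrix.one_mul, Matrix.mul_one]; abel
    rw [Matrix.conjTranspose_mul, Matrix.conjTranspose_sub, Matrix.conjTranspose_sub,
      Matrix.conjTranspose_one, hP.eq, hQ.eq]
    calc (1 - Q) * (1 - P) * ((1 - P) * (1 - Q))
        = (1 - Q) * ((1 - P) * (1 - P)) * (1 - Q) := by noncomm_ring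
      _ = (1 - P) * ((1 - Q) * (1 - Q)) := by rw [eP, ← c, Matrix.mul_assoc]
      _ = _ := by rw [eQ]; noncomm_ring
  have h := re_trace_mul_nonneg (posSemidef_conjTranspose_mul_self ((1 - P) * (1 - Q))) hρ
  rw [e] at h
  simp only [Matrix.add_mul, Matrix.sub_mul, Matrix.one_mul, Matrix.trace_add, Matrix.trace_sub,
    hρ.2, Complex.add_re, Complex.sub_re, Complex.one_re] at h
  linarith

/-- If a contraction `S` acts as the identity on the range of the projection `P` and preserves its
orthogonal complement, the latter contributes at least `-1` to the expectation of `S`. -/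
lemma two_mul_sub_one_le_re_trace {S P ρ : Matrix n n ℂ} (hS : (1 - Sᴴ * S).PosSemidef)
    (hP : P.IsHermitian) (hP' : P * P = P) (hSP : S * P = P) (hPS : P * S = P)
    (hρ : IsDensityMatrix ρ) : 2 * (P * ρ).trace.re - 1 ≤ (S * ρ).trace.re := by
  have hSP' : Sᴴ * P = P := by
    simpa [Matrix.conjTranspose_mul, hP.eq] using congrArg conjTranspose hPS
  have hPS' : P * Sᴴ = P := by
    simpa [Matrix.conjTranspose_mul, hP.eq] using congrArg conjTranspose hSP
  have e : (S + 1 - (P + P))ᴴ * (S + 1 - (P + P)) + (1 - Sᴴ * S)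
      = (S + 1 - (P + P)) + (S + 1 - (P + P))ᴴ := by
    rw [Matrix.conjTranspose_sub, Matrix.conjTranspose_add, Matrix.conjTranspose_one,
      Matrix.conjTranspose_add, hP.eq]
    simp only [Matrix.mul_add, Matrix.mul_sub, Matrix.add_mul, Matrix.sub_mul, hSP', hPS, hP',
      Matrix.one_mul, Matrix.mul_one]
    abel
  have h := add_nonneg (re_trace_mul_nonneg
    (posSemidef_conjTranspose_mul_self (S + 1 - (P + P))) hρ) (re_trace_mul_nonneg hS hρ)
  rw [← Complex.add_re, ← Matrix.trace_add, ← Matrix.add_mul, e, Matrix.add_mul, Matrix.trace_add,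
    Complex.add_re, re_trace_conjTranspose_mul hρ.1.isHermitian] at h
  simp only [Matrix.add_mul, Matrix.sub_mul, Matrix.one_mul, Matrix.trace_add, Matrix.trace_sub,
    hρ.2, Complex.add_re, Complex.sub_re, Complex.one_re] at h
  linarith

/-- Nonnegativity of the variance of `X A + Y B`, with `X, Y` the real parts of the expectations of
`A` and `B`, together with the same statement for the adjoints: the sum of the two involves `A` and
`B` only through the anticommutator of `A` and `Bᴴ`. -/
lemma sq_sq_add_sq_le {A B ρ : Matrix n n ℂ} (hA : IsContraction A) (hB : IsContraction B)
    (hρ : IsDensityMatrix ρ) {X Y : ℝ} (hX : X = (A * ρ).trace.re) (hY : Y = (B * ρ).trace.re) :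
    (X ^ 2 + Y ^ 2) ^ 2 ≤ X ^ 2 + Y ^ 2 + X * Y * (anticommutator A Bᴴ * ρ).trace.re := by
  set c : ℝ := X ^ 2 + Y ^ 2 with hc
  set D : Matrix n n ℂ := (X : ℂ) • A + (Y : ℂ) • B - (c : ℂ) • 1 with hD
  have h1 := re_trace_mul_nonneg (posSemidef_conjTranspose_mul_self D) hρ
  have h2 := re_trace_mul_nonneg (posSemidef_self_mul_conjTranspose D) hρ
  have a1 := re_trace_mul_nonneg hA.1 hρ
  have a2 := re_trace_mul_nonneg hA.2 hρ
  have b1 := re_trace_mul_nonneg hB.1 hρ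
  have b2 := re_trace_mul_nonneg hB.2 hρ
  have e1 : (Aᴴ * B * ρ).trace.re = (Bᴴ * A * ρ).trace.re := by
    rw [← re_trace_conjTranspose_mul hρ.1.isHermitian]; simp [Matrix.conjTranspose_mul]
  have e2 : (B * Aᴴ * ρ).trace.re = (A * Bᴴ * ρ).trace.re := by
    rw [← re_trace_conjTranspose_mul hρ.1.isHermitian]; simp [Matrix.conjTranspose_mul]
  have e3 := re_trace_conjTranspose_mul (A := A) hρ.1.isHermitian
  have e4 := re_trace_conjTranspose_mul (A := B) hρ.1.isHermitian
  have hDh : Dᴴ = (X : ℂ) • Aᴴ + (Y : ℂ) • Bᴴ - (c : ℂ) • 1 := by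
    simp [hD, Matrix.conjTranspose_smul, Matrix.conjTranspose_sub, Matrix.conjTranspose_add]
  rw [hDh, hD] at h1 h2
  simp only [anticommutator, Matrix.add_mul, Matrix.sub_mul, Matrix.mul_add, Matrix.mul_sub,
    Matrix.one_mul, Matrix.mul_one, Matrix.smul_mul, Matrix.mul_smul, Matrix.trace_add,
    Matrix.trace_sub, Matrix.trace_smul, hρ.2, Complex.add_re, Complex.sub_re, Complex.one_re,
    smul_eq_mul, Complex.re_ofReal_mul, e1, e2, e3, e4, ← hX, ← hY] at h1 h2 a1 a2 b1 b2 ⊢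
  nlinarith [mul_nonneg (sq_nonneg X) a1, mul_nonneg (sq_nonneg X) a2,
    mul_nonneg (sq_nonneg Y) b1, mul_nonneg (sq_nonneg Y) b2]

/-- If both expectations of two contractions reach `1` in a state, the two contractions have a
common nonzero fixed vector. -/
lemma exists_common_fixed_vector {A B ρ : Matrix n n ℂ} (hA : IsContraction A)
    (hB : IsContraction B) (hρ : IsDensityMatrix ρ) (hA1 : 1 ≤ (A * ρ).trace.re)
    (hB1 : 1 ≤ (B * ρ).trace.re) : ∃ φ : n → ℂ, φ ≠ 0 ∧ A *ᵥ φ = φ ∧ B *ᵥ φ = φ := by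
  obtain ⟨C, hC⟩ : ∃ C : Matrix n n ℂ, ρ = C * Cᴴ := by
    open scoped MatrixOrder Matrix.Norms.L2Operator in
    obtain ⟨C, hC⟩ := CStarAlgebra.nonneg_iff_eq_star_mul_self.mp hρ.1.nonneg
    exact ⟨Cᴴ, by rw [conjTranspose_conjTranspose]; exact hC⟩
  have key : ∀ S : Matrix n n ℂ, IsContraction S → 1 ≤ (S * ρ).trace.re → S * C = C := by
    intro S hS h1
    have a := re_trace_mul_nonneg hS.1 hρ
    have b := hρ.1.trace_mul_nonneg (posSemidef_conjTranspose_mul_self (S - 1))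
    have hle : ((S - 1)ᴴ * (S - 1) * ρ).trace.re ≤ 0 := by
      rw [Matrix.conjTranspose_sub, Matrix.conjTranspose_one]
      simp only [Matrix.sub_mul, Matrix.mul_sub, Matrix.one_mul, Matrix.mul_one,
        Matrix.trace_sub, Complex.sub_re, hρ.2, re_trace_conjTranspose_mul hρ.1.isHermitian,
        Complex.one_re] at a ⊢
      linarith
    rw [Matrix.trace_mul_comm] at b
    have h0 : ((S - 1)ᴴ * (S - 1) * ρ).trace = 0 :=
      le_antisymm (Complex.le_def.2 ⟨hle, (Complex.le_def.1 b).2.symm⟩) b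
    have h2 : (((S - 1) * C)ᴴ * ((S - 1) * C)).trace = 0 := by
      rw [← h0, hC, Matrix.conjTranspose_mul, Matrix.mul_assoc Cᴴ, Matrix.trace_mul_comm Cᴴ]
      simp only [Matrix.mul_assoc]
    have h3 := trace_conjTranspose_mul_self_eq_zero_iff.1 h2
    rwa [Matrix.sub_mul, Matrix.one_mul, sub_eq_zero] at h3
  have hC0 : C ≠ 0 := by
    rintro rfl
    have := hρ.2
    simp [hC] at this
  obtain ⟨j, hj⟩ : ∃ j, C.col j ≠ 0 := by
    by_contra! h
    exact hC0 (Matrix.ext fun i j => congrFun (h j) i)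
  exact ⟨C.col j, hj, funext fun i => congrFun (congrFun (key A hA hA1) i) j,
    funext fun i => congrFun (congrFun (key B hB hB1) i) j⟩

end Expectation

/-! ### The numerical radius -/

section NumericalRadius

variable {n : Type*} [Fintype n]

open scoped Matrix.Norms.L2Operator in
lemma norm_star_dotProduct_mulVec_le [DecidableEq n] (T : Matrix n n ℂ) {φ : n → ℂ}
    (hφ : star φ ⬝ᵥ φ = 1) : ‖star φ ⬝ᵥ T *ᵥ φ‖ ≤ ‖T‖ := by
  have h1 : ‖WithLp.toLp 2 φ‖ = 1 := by
    have : ‖WithLp.toLp 2 φ‖ ^ 2 = 1 := by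
      have h := @inner_self_eq_norm_sq_to_K ℂ (EuclideanSpace ℂ n) _ _ _ (WithLp.toLp 2 φ)
      rw [EuclideanSpace.inner_eq_star_dotProduct, dotProduct_comm] at h
      simp only [hφ] at h
      exact RCLike.ofReal_injective (K := ℂ) (by push_cast; exact h.symm)
    nlinarith [norm_nonneg (WithLp.toLp 2 φ)]
  have h2 := norm_inner_le_norm (𝕜 := ℂ) (WithLp.toLp 2 φ) (WithLp.toLp 2 (T *ᵥ φ))
  rw [EuclideanSpace.inner_eq_star_dotProduct, dotProduct_comm, h1, one_mul] at h2
  have h3 := Matrix.l2_opNorm_mulVec T (WithLp.toLp 2 φ)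
  rw [h1, mul_one] at h3
  exact h2.trans h3

lemma bddAbove_abs_expectation (T : Matrix n n ℂ) :
    BddAbove {r : ℝ | ∃ φ : n → ℂ, star φ ⬝ᵥ φ = 1 ∧ r = ‖star φ ⬝ᵥ T *ᵥ φ‖} := by
  classical
  open scoped Matrix.Norms.L2Operator in
  refine ⟨‖T‖, ?_⟩
  rintro r ⟨φ, hφ, rfl⟩
  exact norm_star_dotProduct_mulVec_le T hφ

lemma norm_star_dotProduct_mulVec_le_maxAbsExpectation (T : Matrix n n ℂ) (φ : n → ℂ) :
    ‖star φ ⬝ᵥ T *ᵥ φ‖ ≤ maxAbsExpectation T * (star φ ⬝ᵥ φ).re := by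
  have h0 : 0 ≤ star φ ⬝ᵥ φ := dotProduct_star_self_nonneg φ
  have hre := Complex.le_def.1 h0
  have hs : star φ ⬝ᵥ φ = (((star φ ⬝ᵥ φ).re : ℝ) : ℂ) := by
    apply Complex.ext
    · simp
    · simpa using hre.2.symm
  set s := (star φ ⬝ᵥ φ).re with hs'
  have hs0 : 0 ≤ s := hre.1
  rcases hs0.eq_or_lt with h | h
  · rw [← h] at hs
    have : φ = 0 := dotProduct_star_self_eq_zero.1 (by simpa using hs)
    subst this
    simp [← h]
  · have hsq : (√s : ℂ) * √s = s := by exact_mod_cast Real.mul_self_sqrt hs0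
    have hne : (√s : ℂ) ≠ 0 := by exact_mod_cast (Real.sqrt_pos.2 h).ne'
    -- `c • φ` is a unit vector.
    set c : ℂ := (√s : ℂ)⁻¹ with hc
    have hcc : star c * c * s = 1 := by
      rw [hc, star_inv₀, ← hsq]
      simp only [Complex.star_def, Complex.conj_ofReal]
      field_simp
    have hnorm : ‖star c * c‖ * s = 1 := by
      have := congrArg norm hcc
      rwa [norm_mul, Complex.norm_of_nonneg hs0, norm_one] at this
    have hle : ‖star (c • φ) ⬝ᵥ T *ᵥ (c • φ)‖ ≤ maxAbsExpectation T :=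
      le_csSup (bddAbove_abs_expectation T) ⟨c • φ, by
        rw [star_smul, smul_dotProduct, dotProduct_smul, hs, smul_eq_mul, smul_eq_mul,
          ← mul_assoc, hcc], rfl⟩
    rw [star_smul, mulVec_smul, smul_dotProduct, dotProduct_smul, smul_eq_mul, smul_eq_mul,
      ← mul_assoc, norm_mul] at hle
    calc ‖star φ ⬝ᵥ T *ᵥ φ‖ = (‖star c * c‖ * ‖star φ ⬝ᵥ T *ᵥ φ‖) * s := by
          rw [mul_right_comm, hnorm, one_mul]
      _ ≤ _ := mul_le_mul_of_nonneg_right hle hs0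

lemma norm_trace_mul_le_maxAbsExpectation (T : Matrix n n ℂ) {ρ : Matrix n n ℂ}
    (hρ : IsDensityMatrix ρ) : ‖(T * ρ).trace‖ ≤ maxAbsExpectation T := by
  obtain ⟨m, v, hv⟩ := posSemidef_iff_eq_sum_vecMulVec.1 hρ.1
  have h1 : ∀ A : Matrix n n ℂ, (A * ρ).trace = ∑ i, star (v i) ⬝ᵥ A *ᵥ v i := by
    intro A
    rw [hv, Matrix.mul_sum, Matrix.trace_sum]
    refine Finset.sum_congr rfl fun i _ => ?_
    rw [mul_vecMulVec, trace_vecMulVec, dotProduct_comm]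
  have h2 : ∑ i, (star (v i) ⬝ᵥ v i).re = 1 := by
    rw [← Complex.re_sum]
    have : ρ.trace = ∑ i, star (v i) ⬝ᵥ v i := by
      rw [hv, Matrix.trace_sum]
      exact Finset.sum_congr rfl fun i _ => by rw [trace_vecMulVec, dotProduct_comm]
    rw [← this, hρ.2, Complex.one_re]
  calc ‖(T * ρ).trace‖ ≤ ∑ i, ‖star (v i) ⬝ᵥ T *ᵥ v i‖ := by rw [h1]; exact norm_sum_le _ _
    _ ≤ ∑ i, maxAbsExpectation T * (star (v i) ⬝ᵥ v i).re :=
      Finset.sum_le_sum fun i _ => norm_star_dotProduct_mulVec_le_maxAbsExpectation T (v i)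
    _ = maxAbsExpectation T := by rw [← Finset.mul_sum, h2, mul_one]

open scoped Matrix.Norms.L2Operator in
/-- The operator norm of a normal matrix, which bounds the numerical radius, is its spectral
radius. -/
lemma maxAbsExpectation_le_maxAbsEigenvalue [DecidableEq n] [Nonempty n] (T : Matrix n n ℂ)
    [IsStarNormal T] : maxAbsExpectation T ≤ maxAbsEigenvalue T := by
  obtain ⟨z, hz, hz'⟩ := spectrum.exists_nnnorm_eq_spectralRadius T
  rw [IsStarNormal.spectralRadius_eq_nnnorm, ENNReal.coe_inj] at hz'
  have hbdd : BddAbove {r : ℝ | ∃ μ : ℂ, Module.End.HasEigenvalue (Matrix.toLin' T) μ ∧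
      r = ‖μ‖} := by
    refine ⟨‖T‖, ?_⟩
    rintro r ⟨μ, hμ, rfl⟩
    rw [Module.End.hasEigenvalue_iff_mem_spectrum, Matrix.spectrum_toLin'] at hμ
    exact spectrum.norm_le_norm_of_mem hμ
  have hle : ‖T‖ ≤ maxAbsEigenvalue T := by
    refine le_csSup hbdd ⟨z, ?_, (congrArg NNReal.toReal hz').symm⟩
    rwa [Module.End.hasEigenvalue_iff_mem_spectrum, Matrix.spectrum_toLin']
  have hT : 0 ≤ ‖T‖ := norm_nonneg _
  refine Real.sSup_le ?_ (hT.trans hle)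
  rintro r ⟨φ, hφ, rfl⟩
  exact (norm_star_dotProduct_mulVec_le T hφ).trans hle

end NumericalRadius

/-! ### The projection onto the fixed vectors of a normal matrix -/

section FixedProjection

open Polynomial

variable {n : Type*} [Fintype n]

lemma conjTranspose_mul_eq_zero_of_normal {A Z : Matrix n n ℂ} (hA : Aᴴ * A = A * Aᴴ)
    (h : A * Z = 0) : Aᴴ * Z = 0 := by
  rw [← conjTranspose_mul_self_eq_zero, conjTranspose_mul, conjTranspose_conjTranspose,
    Matrix.mul_assoc, ← Matrix.mul_assoc A, ← hA, Matrix.mul_assoc, h, Matrix.mul_zero,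
    Matrix.mul_zero]

lemma mul_eq_zero_of_normal_of_mul_mul {A Z : Matrix n n ℂ} (hA : Aᴴ * A = A * Aᴴ)
    (h : A * (A * Z) = 0) : A * Z = 0 := by
  have h' := conjTranspose_mul_eq_zero_of_normal hA h
  rw [← conjTranspose_mul_self_eq_zero, conjTranspose_mul, Matrix.mul_assoc, h', Matrix.mul_zero]

variable [DecidableEq n]

lemma aeval_mul_of_mul_eq {S Z : Matrix n n ℂ} (h : S * Z = Z) (p : ℂ[X]) :
    aeval S p * Z = p.eval 1 • Z := by
  induction p using Polynomial.induction_on with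
  | C a => simp [Algebra.algebraMap_eq_smul_one]
  | add p q hp hq => simp [Matrix.add_mul, hp, hq, add_smul]
  | monomial k a hk =>
    rw [pow_succ, ← mul_assoc, map_mul, aeval_X, Matrix.mul_assoc, h, hk]; simp

lemma mul_aeval_of_mul_eq {S Z : Matrix n n ℂ} (h : Z * S = Z) (p : ℂ[X]) :
    Z * aeval S p = p.eval 1 • Z := by
  induction p using Polynomial.induction_on with
  | C a => simp [Algebra.algebraMap_eq_smul_one]
  | add p q hp hq => simp [Matrix.mul_add, hp, hq, add_smul]
  | monomial k a hk =>
    rw [pow_succ, ← mul_assoc, map_mul, aeval_X, ← Matrix.mul_assoc, hk, Matrix.smul_mul, h]; simp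

lemma aeval_mulVec_of_mulVec_eq {S : Matrix n n ℂ} {ψ : n → ℂ} (h : S *ᵥ ψ = ψ) (p : ℂ[X]) :
    aeval S p *ᵥ ψ = p.eval 1 • ψ := by
  induction p using Polynomial.induction_on with
  | C a => simp [Algebra.algebraMap_eq_smul_one, Matrix.smul_mulVec]
  | add p q hp hq => simp [Matrix.add_mulVec, hp, hq, add_smul]
  | monomial k a hk =>
    rw [pow_succ, ← mul_assoc, map_mul, aeval_X, ← Matrix.mulVec_mulVec, h, hk]; simp

lemma Commute.aeval_aeval {S T : Matrix n n ℂ} (h : Commute S T) (p q : ℂ[X]) :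
    Commute (aeval S p) (aeval T q) := by
  have key : ∀ {S T : Matrix n n ℂ}, Commute S T → ∀ p : ℂ[X], Commute (aeval S p) T := by
    intro S T h p
    induction p using Polynomial.induction_on with
    | C a => rw [aeval_C]; exact Algebra.commutes a T
    | add p q hp hq => simpa using hp.add_left hq
    | monomial k a hk => rw [pow_succ, ← mul_assoc, map_mul, aeval_X]; exact hk.mul_left h
  exact key (key h.symm q).symm p

/-- The orthogonal projection onto the space of the fixed vectors of a normal matrix `S` is a
polynomial in `S`, namely the cofactor of the power of `X - 1` in the minimal polynomial, suitably
scaled. -/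
lemma exists_aeval_eq_fixedProjection {S : Matrix n n ℂ} (hS : Sᴴ * S = S * Sᴴ) :
    ∃ p : ℂ[X], (aeval S p).IsHermitian ∧ S * aeval S p = aeval S p ∧ p.eval 1 = 1 := by
  obtain ⟨q, hq, hq'⟩ := exists_eq_pow_rootMultiplicity_mul_and_not_dvd (minpoly ℂ S)
    (minpoly.ne_zero (Algebra.IsIntegral.isIntegral S)) 1
  have hA : (S - 1)ᴴ * (S - 1) = (S - 1) * (S - 1)ᴴ := by
    rw [conjTranspose_sub, conjTranspose_one]
    simp only [Matrix.sub_mul, Matrix.mul_sub, hS, Matrix.one_mul, Matrix.mul_one]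
    abel
  have h0 : (S - 1) ^ rootMultiplicity 1 (minpoly ℂ S) * aeval S q = 0 := by
    have := minpoly.aeval ℂ S
    rw [hq] at this
    simpa using this
  -- `S - 1` is normal, so its powers have the same kernel.
  have h1 : (S - 1) * aeval S q = 0 := by
    generalize rootMultiplicity 1 (minpoly ℂ S) = k at h0
    induction k with
    | zero => rw [pow_zero, Matrix.one_mul] at h0; rw [h0, Matrix.mul_zero]
    | succ k ih =>
      cases k with
      | zero => simpa using h0
      | succ k =>
        apply ih
        rw [pow_succ', Matrix.mul_assoc] at h0 ⊢
        rw [pow_succ', Matrix.mul_assoc] at h0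
        exact mul_eq_zero_of_normal_of_mul_mul hA h0
  have hq1 : q.eval 1 ≠ 0 := fun h => hq' (dvd_iff_isRoot.2 h)
  set p : ℂ[X] := C (q.eval 1)⁻¹ * q with hp
  have hp1 : p.eval 1 = 1 := by simp [hp, hq1]
  have h2 : (S - 1) * aeval S p = 0 := by
    rw [hp, map_mul, aeval_C, Algebra.algebraMap_eq_smul_one, Matrix.smul_mul, Matrix.one_mul,
      Matrix.mul_smul, h1, smul_zero]
  have hSP : S * aeval S p = aeval S p := by
    rwa [Matrix.sub_mul, Matrix.one_mul, sub_eq_zero] at h2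
  refine ⟨p, ?_, hSP, hp1⟩
  have h3 := conjTranspose_mul_eq_zero_of_normal hA h2
  have h4 : (aeval S p)ᴴ * S = (aeval S p)ᴴ := by
    have := congrArg conjTranspose h3
    rwa [conjTranspose_mul, conjTranspose_conjTranspose, conjTranspose_zero, Matrix.mul_sub,
      Matrix.mul_one, sub_eq_zero] at this
  have h5 := mul_aeval_of_mul_eq h4 p
  rw [hp1, one_smul] at h5
  rw [Matrix.IsHermitian]
  conv_rhs => rw [← conjTranspose_conjTranspose (aeval S p), ← h5]
  rw [conjTranspose_mul, conjTranspose_conjTranspose, h5]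

end FixedProjection

/-! ### Partial traces -/

section PartialTrace

open scoped Kronecker

variable {m n : Type*} [Fintype m] [Fintype n]

/-- The partial trace over the second factor. -/
def partialTrace (ρ : Matrix (m × n) (m × n) ℂ) : Matrix m m ℂ :=
  ∑ k, ρ.submatrix (fun i => (i, k)) (fun i => (i, k))

lemma trace_mul_partialTrace [DecidableEq n] (A : Matrix m m ℂ) (ρ : Matrix (m × n) (m × n) ℂ) :
    (A * partialTrace ρ).trace = ((A ⊗ₖ (1 : Matrix n n ℂ)) * ρ).trace := by
  simp only [Matrix.trace, partialTrace, Matrix.diag_apply, Matrix.mul_apply, Matrix.sum_apply,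
    submatrix_apply, Fintype.sum_prod_type, kroneckerMap_apply, one_apply, mul_ite, mul_one,
    mul_zero, ite_mul, zero_mul, Finset.sum_ite_eq, Finset.mem_univ, if_true, Finset.mul_sum]

lemma IsDensityMatrix.partialTrace {ρ : Matrix (m × n) (m × n) ℂ} (hρ : IsDensityMatrix ρ) :
    IsDensityMatrix (partialTrace ρ) := by
  classical
  refine ⟨posSemidef_sum _ fun k _ => hρ.1.submatrix _, ?_⟩
  have h := trace_mul_partialTrace (1 : Matrix m m ℂ) ρ
  rwa [Matrix.one_mul, one_kronecker_one, Matrix.one_mul, hρ.2] at h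

lemma trace_submatrix_equiv (A : Matrix m m ℂ) (e : n ≃ m) :
    (A.submatrix e e).trace = A.trace :=
  Equiv.sum_comp e fun i => A i i

lemma IsDensityMatrix.submatrix_equiv {ρ : Matrix m m ℂ} (hρ : IsDensityMatrix ρ) (e : n ≃ m) :
    IsDensityMatrix (ρ.submatrix e e) :=
  ⟨hρ.1.submatrix e, by rw [trace_submatrix_equiv, hρ.2]⟩

end PartialTrace

/-! ### Exchanging parties between two copies of the system -/

section Swap

open scoped Kronecker

variable {J : Type*} {β : J → Type*}

/-- Exchanges the coordinates in `G` of two configurations. -/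
def swapOn [DecidableEq J] (G : Finset J) :
    ((j : J) → β j) × ((j : J) → β j) ≃ ((j : J) → β j) × ((j : J) → β j) :=
  Function.Involutive.toPerm
    (fun z => (fun j => if j ∈ G then z.2 j else z.1 j, fun j => if j ∈ G then z.1 j else z.2 j))
    (fun z => by
      ext j <;> by_cases h : j ∈ G <;> simp [h])

lemma swapOn_fst [DecidableEq J] (G : Finset J) (z : ((j : J) → β j) × ((j : J) → β j)) (j : J) :
    (swapOn G z).1 j = if j ∈ G then z.2 j else z.1 j := rfl

lemma swapOn_snd [DecidableEq J] (G : Finset J) (z : ((j : J) → β j) × ((j : J) → β j)) (j : J) :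
    (swapOn G z).2 j = if j ∈ G then z.1 j else z.2 j := rfl

lemma onOriginal_eq_kronecker {V : Type*} {ι : V → Type*} [∀ v, DecidableEq (ι v)] (G : Finset V)
    (S : Matrix ((v : V) → ι v) ((v : V) → ι v) ℂ) :
    onOriginal G S = S ⊗ₖ (1 : Matrix ((v : {v : V // v ∈ G}) → ι v.1)
      ((v : {v : V // v ∈ G}) → ι v.1) ℂ) := by
  ext x y
  simp [onOriginal, one_apply]

variable {V : Type*} [DecidableEq V] {ι : V → Type*}

/-- Two copies of the parties `V`, arranged as the parties `V` together with the copy of `G` on the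
one hand, and the copy of the other parties on the other hand. -/
def withCopyProdEquiv (ι : V → Type*) (G : Finset V) :
    WithCopy ι G × ((v : {v : V // v ∉ G}) → ι v.1) ≃ ((v : V) → ι v) × ((v : V) → ι v) :=
  (Equiv.prodAssoc _ _ _).trans
    (Equiv.prodCongr (Equiv.refl _) (Equiv.piEquivPiSubtypeProd (· ∈ G) ι).symm)

lemma withCopyProdEquiv_fst (G : Finset V)
    (x : WithCopy ι G × ((v : {v : V // v ∉ G}) → ι v.1)) :
    (withCopyProdEquiv ι G x).1 = x.1.1 := rfl

lemma withCopyProdEquiv_snd (G : Finset V)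
    (x : WithCopy ι G × ((v : {v : V // v ∉ G}) → ι v.1)) (v : V) :
    (withCopyProdEquiv ι G x).2 v = if h : v ∈ G then x.1.2 ⟨v, h⟩ else x.2 ⟨v, h⟩ := rfl

lemma withCopyProdEquiv_snd_eq_iff (G : Finset V)
    (x y : WithCopy ι G × ((v : {v : V // v ∉ G}) → ι v.1)) :
    (withCopyProdEquiv ι G x).2 = (withCopyProdEquiv ι G y).2 ↔ x.1.2 = y.1.2 ∧ x.2 = y.2 := by
  rw [← Prod.mk.injEq]
  exact (Equiv.apply_eq_iff_eq (Equiv.piEquivPiSubtypeProd (· ∈ G) ι).symm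
    (x := (x.1.2, x.2)) (y := (y.1.2, y.2)))

variable [∀ v, DecidableEq (ι v)]

variable [Fintype V]

lemma onOriginal_kronecker_one (G : Finset V) (S : Matrix ((v : V) → ι v) ((v : V) → ι v) ℂ) :
    onOriginal G S ⊗ₖ (1 : Matrix ((v : {v : V // v ∉ G}) → ι v.1)
        ((v : {v : V // v ∉ G}) → ι v.1) ℂ) =
      (S ⊗ₖ (1 : Matrix ((v : V) → ι v) ((v : V) → ι v) ℂ)).submatrix (withCopyProdEquiv ι G)
        (withCopyProdEquiv ι G) := by
  ext x y
  simp only [kroneckerMap_apply, onOriginal, submatrix_apply, one_apply,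
    withCopyProdEquiv_snd_eq_iff, withCopyProdEquiv_fst, mul_assoc, ite_and]
  congr 1
  split_ifs <;> simp

/-- The permutation of the basis which exchanges the parties in `G` with their copy. -/
def swapCopy (ι : V → Type*) (G : Finset V) : WithCopy ι G ≃ WithCopy ι G :=
  Function.Involutive.toPerm (fun x => (swapIn G x, fun v => x.1 v.1)) (fun x => by
    ext v
    · by_cases h : v ∈ G <;> simp [swapIn, h]
    · simp [swapIn])

lemma onCopy_eq_submatrix (G : Finset V) (S : Matrix ((v : V) → ι v) ((v : V) → ι v) ℂ) :
    onCopy G S = (onOriginal G S).submatrix (swapCopy ι G) (swapCopy ι G) := by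
  ext x y
  have h : (swapCopy ι G x).2 = (swapCopy ι G y).2 ↔ ∀ v ∈ G, x.1 v = y.1 v := by
    rw [funext_iff, Subtype.forall]
    rfl
  simp only [onCopy, onOriginal, submatrix_apply, h]
  rfl

lemma onCopy_kronecker_one (G : Finset V) (S : Matrix ((v : V) → ι v) ((v : V) → ι v) ℂ) :
    onCopy G S ⊗ₖ (1 : Matrix ((v : {v : V // v ∉ G}) → ι v.1)
        ((v : {v : V // v ∉ G}) → ι v.1) ℂ) =
      ((S ⊗ₖ (1 : Matrix ((v : V) → ι v) ((v : V) → ι v) ℂ)).submatrix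
        (swapOn G) (swapOn G)).submatrix (withCopyProdEquiv ι G) (withCopyProdEquiv ι G) := by
  have h1 : ∀ x, (swapOn G (withCopyProdEquiv ι G x)).1 = swapIn G x.1 := by
    intro x
    ext v
    by_cases h : v ∈ G <;>
      simp [swapOn_fst, withCopyProdEquiv_fst, withCopyProdEquiv_snd, swapIn, h]
  have h2 : ∀ x y, (swapOn G (withCopyProdEquiv ι G x)).2 = (swapOn G (withCopyProdEquiv ι G y)).2 ↔
      (∀ v ∈ G, x.1.1 v = y.1.1 v) ∧ x.2 = y.2 := by
    intro x y
    simp only [funext_iff, swapOn_snd, withCopyProdEquiv_fst, withCopyProdEquiv_snd]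
    constructor
    · intro h
      exact ⟨fun v hv => by simpa [hv] using h v, fun v => by simpa [v.2] using h v.1⟩
    · rintro ⟨h, h'⟩ v
      by_cases hv : v ∈ G
      · simpa [hv] using h v hv
      · simpa [hv] using h' ⟨v, hv⟩
  ext x y
  simp only [kroneckerMap_apply, onCopy, submatrix_apply, one_apply, h1, h2, mul_assoc, ite_and]
  congr 1
  split_ifs <;> simp

lemma IsContraction.kronecker_one {m n : Type*} [Fintype m] [Fintype n] [DecidableEq m]
    [DecidableEq n] {S : Matrix m m ℂ} (hS : IsContraction S) :
    IsContraction (S ⊗ₖ (1 : Matrix n n ℂ)) := by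
  have e : ∀ A : Matrix m m ℂ, (1 - A) ⊗ₖ (1 : Matrix n n ℂ) = 1 - A ⊗ₖ (1 : Matrix n n ℂ) := by
    intro A
    ext x y
    simp only [kroneckerMap_apply, Matrix.sub_apply, sub_mul]
    rw [← one_kronecker_one, kroneckerMap_apply]
  constructor
  · have h := hS.1.kronecker (PosSemidef.one (n := n) (R := ℂ))
    rw [e] at h
    rwa [conjTranspose_kronecker, ← mul_kronecker_mul, conjTranspose_one, Matrix.one_mul]
  · have h := hS.2.kronecker (PosSemidef.one (n := n) (R := ℂ))
    rw [e] at h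
    rwa [conjTranspose_kronecker, ← mul_kronecker_mul, conjTranspose_one, Matrix.one_mul]

lemma IsContraction.submatrix_equiv {m n : Type*} [Fintype m] [Fintype n] [DecidableEq m]
    [DecidableEq n] {S : Matrix m m ℂ} (hS : IsContraction S) (e : n ≃ m) :
    IsContraction (S.submatrix e e) := by
  have h : ∀ A : Matrix m m ℂ, (1 - A).submatrix e e = 1 - A.submatrix e e := by
    intro A
    rw [← submatrix_one_equiv e]
    rfl
  constructor
  · rw [conjTranspose_submatrix, submatrix_mul_equiv, ← h]
    exact hS.1.submatrix e
  · rw [conjTranspose_submatrix, submatrix_mul_equiv, ← h]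
    exact hS.2.submatrix e

variable [∀ v, Fintype (ι v)]

lemma IsContraction.onOriginal {S : Matrix ((v : V) → ι v) ((v : V) → ι v) ℂ}
    (hS : IsContraction S) (G : Finset V) : IsContraction (onOriginal G S) := by
  rw [onOriginal_eq_kronecker]; exact hS.kronecker_one

lemma IsContraction.onCopy {S : Matrix ((v : V) → ι v) ((v : V) → ι v) ℂ}
    (hS : IsContraction S) (G : Finset V) : IsContraction (onCopy G S) := by
  rw [onCopy_eq_submatrix]; exact (hS.onOriginal G).submatrix_equiv _

end Swap

/-! ### Local channels in the Heisenberg picture -/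

section NoSupport

open scoped Kronecker

variable {V : Type*} [Fintype V] [DecidableEq V] {ι : V → Type*} [∀ v, DecidableEq (ι v)]
  {S T : Matrix ((v : V) → ι v) ((v : V) → ι v) ℂ} {G : Finset V}

lemma noSupportIn_iff : NoSupportIn S G ↔
    ∃ R : Matrix ((v : {v : V // v ∉ G}) → ι v.1) ((v : {v : V // v ∉ G}) → ι v.1) ℂ,
      S = ((1 : Matrix ((v : {v : V // v ∈ G}) → ι v.1)
          ((v : {v : V // v ∈ G}) → ι v.1) ℂ) ⊗ₖ R).submatrix
        (Equiv.piEquivPiSubtypeProd (· ∈ G) ι) (Equiv.piEquivPiSubtypeProd (· ∈ G) ι) := by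
  refine exists_congr fun R => ?_
  rw [← Matrix.ext_iff]
  refine forall_congr' fun x => forall_congr' fun y => ?_
  simp [one_apply, funext_iff, Equiv.piEquivPiSubtypeProd]

lemma NoSupportIn.add (hS : NoSupportIn S G) (hT : NoSupportIn T G) : NoSupportIn (S + T) G := by
  obtain ⟨R, hR⟩ := hS
  obtain ⟨R', hR'⟩ := hT
  exact ⟨R + R', fun x y => by simp only [Matrix.add_apply, hR, hR', mul_add]⟩

variable [∀ v, Fintype (ι v)]

lemma NoSupportIn.mul (hS : NoSupportIn S G) (hT : NoSupportIn T G) : NoSupportIn (S * T) G := by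
  rw [noSupportIn_iff] at *
  obtain ⟨R, rfl⟩ := hS
  obtain ⟨R', rfl⟩ := hT
  exact ⟨R * R', by rw [submatrix_mul_equiv, ← mul_kronecker_mul, Matrix.one_mul]⟩

lemma noSupportIn_algebraMap (c : ℂ) :
    NoSupportIn (algebraMap ℂ (Matrix ((v : V) → ι v) ((v : V) → ι v) ℂ) c) G := by
  rw [noSupportIn_iff]
  refine ⟨c • 1, ?_⟩
  rw [kronecker_smul, one_kronecker_one, Algebra.algebraMap_eq_smul_one, submatrix_smul]
  simp

lemma NoSupportIn.aeval (hS : NoSupportIn S G) (p : Polynomial ℂ) :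
    NoSupportIn (Polynomial.aeval S p) G := by
  induction p using Polynomial.induction_on with
  | C a => simpa using noSupportIn_algebraMap a
  | add p q hp hq => simpa using hp.add hq
  | monomial k a hk =>
    rw [pow_succ, ← mul_assoc, map_mul, Polynomial.aeval_X]
    exact hk.mul hS

end NoSupport

lemma trace_mul_mul_mul_conjTranspose {m n : Type*} [Fintype m] [Fintype n] (O : Matrix m m ℂ)
    (K : Matrix m n ℂ) (X : Matrix n n ℂ) : (O * (K * X * Kᴴ)).trace = (Kᴴ * O * K * X).trace := by
  rw [← Matrix.mul_assoc, Matrix.trace_mul_comm]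
  simp only [Matrix.mul_assoc]

namespace QuantumNetwork

open scoped Kronecker

variable {V : Type*}

lemma received_injective {N : QuantumNetwork V} {dim : N.Source → V → ℕ} {x y : N.Particles dim}
    (h : ∀ v, N.received v x = N.received v y) : x = y :=
  funext fun e => funext fun v => congrFun (h v.1) ⟨e, v.2⟩

variable [DecidableEq V] (N : QuantumNetwork V)
  {dim : N.Source → V → ℕ} {ι : V → Type*} [∀ v, Fintype (ι v)]

/-- The matrix elements of the dual of the local channel of the party `v`. -/
def dualKernel (E : (v : V) → QuantumChannel (N.Received dim v) (ι v)) (v : V) (i j : ι v)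
    (a b : N.Received dim v) : ℂ :=
  ∑ k, star ((E v).kraus k i a) * (E v).kraus k j b

lemma sum_dualKernel {N : QuantumNetwork V} {dim : N.Source → V → ℕ}
    (E : (v : V) → QuantumChannel (N.Received dim v) (ι v)) (v : V) (a b : N.Received dim v) :
    ∑ i, N.dualKernel E v i i a b = if a = b then 1 else 0 := by
  have h := congrFun (congrFun (E v).trace_preserving a) b
  rw [Matrix.sum_apply, one_apply] at h
  rw [← h]
  simp only [dualKernel, Matrix.mul_apply, conjTranspose_apply]
  exact Finset.sum_comm

variable [Fintype V]

/-- The dual of the tensor product of the local channels `E v`, applied to the observable `O`. -/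
def dualLocal (E : (v : V) → QuantumChannel (N.Received dim v) (ι v))
    (O : Matrix ((v : V) → ι v) ((v : V) → ι v) ℂ) :
    Matrix (N.Particles dim) (N.Particles dim) ℂ :=
  ∑ k : (v : V) → Fin (E v).rank,
    (N.tensorLocal (fun v => (E v).kraus (k v)))ᴴ * O *
      N.tensorLocal (fun v => (E v).kraus (k v))

variable {N}
variable (E : (v : V) → QuantumChannel (N.Received dim v) (ι v))

lemma dualLocal_apply (O : Matrix ((v : V) → ι v) ((v : V) → ι v) ℂ) (x y : N.Particles dim) :
    N.dualLocal E O x y = ∑ i, ∑ j, O i j *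
      ∏ v, N.dualKernel E v (i v) (j v) (N.received v x) (N.received v y) := by
  have h : ∀ i j : (v : V) → ι v,
      ∏ v, N.dualKernel E v (i v) (j v) (N.received v x) (N.received v y) =
      ∑ k : (v : V) → Fin (E v).rank,
        star (∏ v, (E v).kraus (k v) (i v) (N.received v x)) *
          ∏ v, (E v).kraus (k v) (j v) (N.received v y) := by
    intro i j
    simp only [dualKernel]
    rw [Finset.prod_univ_sum, Fintype.piFinset_univ]
    refine Finset.sum_congr rfl fun k _ => ?_
    rw [Finset.prod_mul_distrib, star_prod]
  simp only [h, dualLocal, Matrix.sum_apply, Matrix.mul_apply, conjTranspose_apply, tensorLocal,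
    Finset.sum_mul, Finset.mul_sum]
  rw [Finset.sum_comm]
  refine (Finset.sum_congr rfl fun j _ => Finset.sum_comm).trans ?_
  rw [Finset.sum_comm]
  refine Finset.sum_congr rfl fun i _ => Finset.sum_congr rfl fun j _ =>
    Finset.sum_congr rfl fun k _ => ?_
  ring

lemma trace_mul_applyLocal (O : Matrix ((v : V) → ι v) ((v : V) → ι v) ℂ)
    (X : Matrix (N.Particles dim) (N.Particles dim) ℂ) :
    (O * N.applyLocal E X).trace = (N.dualLocal E O * X).trace := by
  simp only [applyLocal, dualLocal, Matrix.mul_sum, Matrix.sum_mul, Matrix.trace_sum]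
  exact Finset.sum_congr rfl fun k _ => trace_mul_mul_mul_conjTranspose _ _ _

variable [∀ v, DecidableEq (ι v)]

lemma dualLocal_one : N.dualLocal E (1 : Matrix ((v : V) → ι v) ((v : V) → ι v) ℂ) = 1 := by
  ext x y
  have h : N.dualLocal E (1 : Matrix ((v : V) → ι v) ((v : V) → ι v) ℂ) x y =
      ∏ v, ∑ i, N.dualKernel E v i i (N.received v x) (N.received v y) := by
    rw [dualLocal_apply, Finset.prod_univ_sum, Fintype.piFinset_univ]
    simp [one_apply]
  rw [h, one_apply]
  simp only [sum_dualKernel]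
  rw [Fintype.prod_ite_zero]
  by_cases hxy : x = y
  · simp [hxy]
  · rw [if_neg hxy, if_neg fun h => hxy (received_injective h)]

/-- The channels of the parties in `G` are trace preserving, so the dual of an observable without
support in `G` acts as the identity on the particles which these parties receive. -/
lemma exists_dualLocal_eq {O : Matrix ((v : V) → ι v) ((v : V) → ι v) ℂ} {G : Finset V}
    (hO : NoSupportIn O G) :
    ∃ R : ((v : {v : V // v ∉ G}) → N.Received dim v.1) →
        ((v : {v : V // v ∉ G}) → N.Received dim v.1) → ℂ,
      ∀ x y, N.dualLocal E O x y =
        (if ∀ v ∈ G, N.received v x = N.received v y then 1 else 0) *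
          R (fun v => N.received v.1 x) (fun v => N.received v.1 y) := by
  obtain ⟨R, hR⟩ := hO
  refine ⟨fun a b => ∑ r, ∑ r', R r r' *
    ∏ v : {v : V // v ∉ G}, N.dualKernel E v.1 (r v) (r' v) (a v) (b v), fun x y => ?_⟩
  have hG : (if ∀ v ∈ G, N.received v x = N.received v y then (1 : ℂ) else 0) =
      ∑ g : (v : {v : V // v ∈ G}) → ι v.1,
        ∏ v, N.dualKernel E v.1 (g v) (g v) (N.received v.1 x) (N.received v.1 y) := by
    have := Finset.prod_univ_sum (fun v : {v : V // v ∈ G} => (Finset.univ : Finset (ι v.1)))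
      (fun v i => N.dualKernel E v.1 i i (N.received v.1 x) (N.received v.1 y))
    rw [Fintype.piFinset_univ] at this
    rw [← this]
    simp only [sum_dualKernel]
    rw [Fintype.prod_ite_zero]
    simp
  rw [dualLocal_apply, hG]
  set e := Equiv.piEquivPiSubtypeProd (· ∈ G) ι with he
  have hsplit : ∀ (g g' : (v : {v : V // v ∈ G}) → ι v.1) (r r' : (v : {v : V // v ∉ G}) → ι v.1),
      O (e.symm (g, r)) (e.symm (g', r')) * ∏ v, N.dualKernel E v (e.symm (g, r) v)
        (e.symm (g', r') v) (N.received v x) (N.received v y) =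
      if g = g' then (∏ v, N.dualKernel E v.1 (g v) (g' v) (N.received v.1 x) (N.received v.1 y)) *
        (R r r' * ∏ v, N.dualKernel E v.1 (r v) (r' v) (N.received v.1 x) (N.received v.1 y))
      else 0 := by
    intro g g' r r'
    have hg : ∀ (g : (v : {v : V // v ∈ G}) → ι v.1) (r : (v : {v : V // v ∉ G}) → ι v.1)
        (v : {v : V // v ∈ G}), e.symm (g, r) v.1 = g v := fun g r v =>
      congrFun (congrArg Prod.fst (e.apply_symm_apply (g, r))) v
    have hr : ∀ (g : (v : {v : V // v ∈ G}) → ι v.1) (r : (v : {v : V // v ∉ G}) → ι v.1)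
        (v : {v : V // v ∉ G}), e.symm (g, r) v.1 = r v := fun g r v =>
      congrFun (congrArg Prod.snd (e.apply_symm_apply (g, r))) v
    have hcond : (∀ v ∈ G, e.symm (g, r) v = e.symm (g', r') v) ↔ g = g' := by
      rw [funext_iff]
      exact ⟨fun h v => by simpa [hg] using h v.1 v.2, fun h v hv => by
        have := h ⟨v, hv⟩
        rwa [← hg g r, ← hg g' r'] at this⟩
    rw [hR, ← Fintype.prod_subtype_mul_prod_subtype (· ∈ G)]
    simp only [hg, hr, hcond]
    split_ifs
    · rw [one_mul, mul_left_comm]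
      congr!
    · simp
  rw [← e.symm.sum_comp, Fintype.sum_prod_type]
  simp only [← e.symm.sum_comp (fun j => O _ j * _), Fintype.sum_prod_type, hsplit]
  rw [Finset.sum_mul]
  refine Finset.sum_congr rfl fun g _ => ?_
  rw [Finset.mul_sum]
  refine Finset.sum_congr rfl fun r _ => ?_
  rw [Finset.sum_comm, Finset.mul_sum]
  refine Finset.sum_congr rfl fun r' _ => ?_
  simp

end QuantumNetwork

/-! ### Two copies of a network with exchanged particles -/

namespace QuantumNetwork

open scoped Kronecker

variable {V : Type*}

lemma posSemidef_sourceState {N : QuantumNetwork V} {dim : N.Source → V → ℕ}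
    {ς : (e : N.Source) → Matrix (N.Emitted dim e) (N.Emitted dim e) ℂ}
    (hς : ∀ e, (ς e).PosSemidef) : (N.sourceState ς).PosSemidef := by
  have key : ∀ s : Finset N.Source, (Matrix.of fun x y : N.Particles dim =>
      ∏ e ∈ s, ς e (x e) (y e)).PosSemidef := by
    intro s
    induction s using Finset.induction_on with
    | empty =>
      convert posSemidef_vecMulVec_self_star (fun _ : N.Particles dim => (1 : ℂ)) using 1
      ext x y
      simp [vecMulVec_apply]
    | insert e s he ih =>
      have h := ((hς e).submatrix (fun x : N.Particles dim => x e)).hadamard ih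
      have h' : (Matrix.of fun x y : N.Particles dim => ∏ e ∈ insert e s, ς e (x e) (y e)) =
          (ς e).submatrix (fun x : N.Particles dim => x e) (fun x => x e) ⊙
            Matrix.of fun x y : N.Particles dim => ∏ e ∈ s, ς e (x e) (y e) := by
        ext x y
        simp [Finset.prod_insert he]
      rw [h']
      exact h
  exact key Finset.univ

variable [DecidableEq V]

lemma trace_sourceState {N : QuantumNetwork V} {dim : N.Source → V → ℕ}
    (ς : (e : N.Source) → Matrix (N.Emitted dim e) (N.Emitted dim e) ℂ) :
    (N.sourceState ς).trace = ∏ e, (ς e).trace := by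
  simp only [Matrix.trace, diag_apply, sourceState]
  rw [Finset.prod_univ_sum, Fintype.piFinset_univ]

lemma isDensityMatrix_sourceState {N : QuantumNetwork V} {dim : N.Source → V → ℕ}
    {ς : (e : N.Source) → Matrix (N.Emitted dim e) (N.Emitted dim e) ℂ}
    (hς : ∀ e, IsDensityMatrix (ς e)) : IsDensityMatrix (N.sourceState ς) :=
  ⟨posSemidef_sourceState fun e => (hς e).1, by
    rw [trace_sourceState]; exact Finset.prod_eq_one fun e _ => (hς e).2⟩

variable (N : QuantumNetwork V) {dim : N.Source → V → ℕ}

/-- Exchanges, between two copies of the network, the particles from the source `e` to the parties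
in `W e`, for every source `e`. -/
def swapParticles (W : N.Source → Finset V) :
    N.Particles dim × N.Particles dim ≃ N.Particles dim × N.Particles dim :=
  Function.Involutive.toPerm
    (fun z => (fun e v => if v.1 ∈ W e then z.2 e v else z.1 e v,
      fun e v => if v.1 ∈ W e then z.1 e v else z.2 e v))
    (fun z => by
      ext e v <;> by_cases h : v.1 ∈ W e <;> simp [h])

variable {N}

lemma swapParticles_fst (W : N.Source → Finset V) (z : N.Particles dim × N.Particles dim)
    (e : N.Source) (v : {v : V // v ∈ N.parties e}) :
    (N.swapParticles W z).1 e v = if v.1 ∈ W e then z.2 e v else z.1 e v := rfl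

lemma swapParticles_snd (W : N.Source → Finset V) (z : N.Particles dim × N.Particles dim)
    (e : N.Source) (v : {v : V // v ∈ N.parties e}) :
    (N.swapParticles W z).2 e v = if v.1 ∈ W e then z.1 e v else z.2 e v := rfl

lemma swapParticles_swapParticles_self (W : N.Source → Finset V)
    (z : N.Particles dim × N.Particles dim) : N.swapParticles W (N.swapParticles W z) = z :=
  (N.swapParticles W).symm_apply_apply z

lemma swapParticles_swapParticles (W U : N.Source → Finset V)
    (z : N.Particles dim × N.Particles dim) :
    N.swapParticles W (N.swapParticles U z) =
      N.swapParticles (fun e => symmDiff (W e) (U e)) z := by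
  ext e v <;> by_cases h : v.1 ∈ W e <;> by_cases h' : v.1 ∈ U e <;>
    simp [swapParticles_fst, swapParticles_snd, Finset.mem_symmDiff, h, h']

/-- The sources of two copies of the network, after the exchange of the particles in `W`. -/
def swappedSources (ς : (e : N.Source) → Matrix (N.Emitted dim e) (N.Emitted dim e) ℂ)
    (W : N.Source → Finset V) :
    Matrix (N.Particles dim × N.Particles dim) (N.Particles dim × N.Particles dim) ℂ :=
  (N.sourceState ς ⊗ₖ N.sourceState ς).submatrix (N.swapParticles W) (N.swapParticles W)

variable (ς : (e : N.Source) → Matrix (N.Emitted dim e) (N.Emitted dim e) ℂ)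

lemma swappedSources_submatrix (W U : N.Source → Finset V) :
    (swappedSources ς W).submatrix (N.swapParticles U) (N.swapParticles U) =
      swappedSources ς fun e => symmDiff (W e) (U e) := by
  ext z w
  simp only [swappedSources, submatrix_apply, swapParticles_swapParticles]

/-- Exchanging all the particles of a source between its two copies has no effect, so the set of
the exchanged particles may be replaced by its complement, independently for every source. -/
lemma swappedSources_congr {W W' : N.Source → Finset V}
    (h : ∀ e, (∀ v ∈ N.parties e, v ∈ W e ↔ v ∈ W' e) ∨
      (∀ v ∈ N.parties e, v ∈ W e ↔ v ∉ W' e)) :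
    swappedSources ς W = swappedSources ς W' := by
  ext z w
  simp only [swappedSources, submatrix_apply, kroneckerMap_apply, sourceState,
    ← Finset.prod_mul_distrib]
  refine Finset.prod_congr rfl fun e _ => ?_
  rcases h e with h | h
  · have h1 : ∀ z : N.Particles dim × N.Particles dim,
        (N.swapParticles W z).1 e = (N.swapParticles W' z).1 e := fun z => funext fun v => by
      simp only [swapParticles_fst, h v.1 v.2]
    have h2 : ∀ z : N.Particles dim × N.Particles dim,
        (N.swapParticles W z).2 e = (N.swapParticles W' z).2 e := fun z => funext fun v => by
      simp only [swapParticles_snd, h v.1 v.2]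
    rw [h1, h1, h2, h2]
  · have h1 : ∀ z : N.Particles dim × N.Particles dim,
        (N.swapParticles W z).1 e = (N.swapParticles W' z).2 e := fun z => funext fun v => by
      simp only [swapParticles_fst, swapParticles_snd, h v.1 v.2, ite_not]
    have h2 : ∀ z : N.Particles dim × N.Particles dim,
        (N.swapParticles W z).2 e = (N.swapParticles W' z).1 e := fun z => funext fun v => by
      simp only [swapParticles_fst, swapParticles_snd, h v.1 v.2, ite_not]
    rw [h1, h1, h2, h2, mul_comm]

variable [Fintype V] {ι : V → Type*} [∀ v, Fintype (ι v)]
  (E : (v : V) → QuantumChannel (N.Received dim v) (ι v))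

/-- The Kraus operators of the local channels of two copies of the network. -/
def twoCopyKraus (k : ((v : V) → Fin (E v).rank) × ((v : V) → Fin (E v).rank)) :
    Matrix (((v : V) → ι v) × ((v : V) → ι v)) (N.Particles dim × N.Particles dim) ℂ :=
  N.tensorLocal (fun v => (E v).kraus (k.1 v)) ⊗ₖ N.tensorLocal (fun v => (E v).kraus (k.2 v))

/-- The state prepared by two copies of the network after the exchange of the particles in `W`
between the copies. -/
def twoCopyState (W : N.Source → Finset V) :
    Matrix (((v : V) → ι v) × ((v : V) → ι v)) (((v : V) → ι v) × ((v : V) → ι v)) ℂ :=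
  ∑ k, twoCopyKraus E k * swappedSources ς W * (twoCopyKraus E k)ᴴ

lemma twoCopyKraus_swap (G : Finset V)
    (k : ((v : V) → Fin (E v).rank) × ((v : V) → Fin (E v).rank)) :
    (twoCopyKraus E k).submatrix (swapOn G) (N.swapParticles fun _ => G) =
      twoCopyKraus E (swapOn G k) := by
  ext i z
  simp only [twoCopyKraus, submatrix_apply, kroneckerMap_apply, tensorLocal,
    ← Finset.prod_mul_distrib]
  refine Finset.prod_congr rfl fun v _ => ?_
  by_cases hv : v ∈ G
  · have h1 : N.received v (N.swapParticles (fun _ => G) z).1 = N.received v z.2 :=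
      funext fun e => by simp [received, swapParticles_fst, hv]
    have h2 : N.received v (N.swapParticles (fun _ => G) z).2 = N.received v z.1 :=
      funext fun e => by simp [received, swapParticles_snd, hv]
    rw [h1, h2]
    simp only [swapOn_fst, swapOn_snd, hv, if_true]
    exact mul_comm _ _
  · have h1 : N.received v (N.swapParticles (fun _ => G) z).1 = N.received v z.1 :=
      funext fun e => by simp [received, swapParticles_fst, hv]
    have h2 : N.received v (N.swapParticles (fun _ => G) z).2 = N.received v z.2 :=
      funext fun e => by simp [received, swapParticles_snd, hv]
    rw [h1, h2]
    simp only [swapOn_fst, swapOn_snd, hv, if_false]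

/-- Exchanging the parties in `G` of the two copies amounts to exchanging all the particles which
they receive. -/
lemma twoCopyState_submatrix (W : N.Source → Finset V) (G : Finset V) :
    (twoCopyState ς E W).submatrix (swapOn G) (swapOn G) =
      twoCopyState ς E fun e => symmDiff (W e) G := by
  have h : ∀ k, (twoCopyKraus E k * swappedSources ς W * (twoCopyKraus E k)ᴴ).submatrix
      (swapOn G) (swapOn G) = twoCopyKraus E (swapOn G k) *
        (swappedSources ς fun e => symmDiff (W e) G) * (twoCopyKraus E (swapOn G k))ᴴ := by
    intro k
    rw [← twoCopyKraus_swap, ← swappedSources_submatrix, conjTranspose_submatrix,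
      submatrix_mul_equiv, submatrix_mul_equiv]
  unfold twoCopyState
  rw [← (swapOn G).sum_comp fun k => twoCopyKraus E k *
    (swappedSources ς fun e => symmDiff (W e) G) * (twoCopyKraus E k)ᴴ]
  simp only [← h]
  ext i j
  simp [Matrix.sum_apply]

variable [∀ v, DecidableEq (ι v)]

lemma trace_kronecker_one_mul_twoCopyState (W : N.Source → Finset V)
    (O : Matrix ((v : V) → ι v) ((v : V) → ι v) ℂ) :
    ((O ⊗ₖ (1 : Matrix ((v : V) → ι v) ((v : V) → ι v) ℂ)) * twoCopyState ς E W).trace =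
      ((N.dualLocal E O ⊗ₖ (1 : Matrix (N.Particles dim) (N.Particles dim) ℂ)) *
        swappedSources ς W).trace := by
  have h : N.dualLocal E O ⊗ₖ (1 : Matrix (N.Particles dim) (N.Particles dim) ℂ) =
      ∑ k, (twoCopyKraus E k)ᴴ * (O ⊗ₖ (1 : Matrix ((v : V) → ι v) ((v : V) → ι v) ℂ)) *
        twoCopyKraus E k := by
    rw [← dualLocal_one E, Fintype.sum_prod_type]
    have hk : ∀ k k', (twoCopyKraus E (k, k'))ᴴ *
        (O ⊗ₖ (1 : Matrix ((v : V) → ι v) ((v : V) → ι v) ℂ)) *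
        twoCopyKraus E (k, k') =
        ((N.tensorLocal fun v => (E v).kraus (k v))ᴴ * O *
          N.tensorLocal fun v => (E v).kraus (k v)) ⊗ₖ
        ((N.tensorLocal fun v => (E v).kraus (k' v))ᴴ *
          (1 : Matrix ((v : V) → ι v) ((v : V) → ι v) ℂ) *
          N.tensorLocal fun v => (E v).kraus (k' v)) := by
      intro k k'
      rw [twoCopyKraus, conjTranspose_kronecker, mul_kronecker_mul, mul_kronecker_mul]
    simp only [hk]
    ext z w
    simp only [dualLocal, kroneckerMap_apply, Matrix.sum_apply, Finset.sum_mul_sum]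
  rw [h, twoCopyState]
  simp only [Matrix.mul_sum, Matrix.sum_mul, Matrix.trace_sum]
  exact Finset.sum_congr rfl fun k _ => trace_mul_mul_mul_conjTranspose _ _ _

lemma dualLocal_kronecker_one_submatrix {O : Matrix ((v : V) → ι v) ((v : V) → ι v) ℂ}
    {G : Finset V} (hO : NoSupportIn O G) {U : N.Source → Finset V}
    (hU : ∀ e, ∀ v ∈ N.parties e, v ∈ U e → v ∈ G) :
    (N.dualLocal E O ⊗ₖ (1 : Matrix (N.Particles dim) (N.Particles dim) ℂ)).submatrix
      (N.swapParticles U) (N.swapParticles U) =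
      N.dualLocal E O ⊗ₖ (1 : Matrix (N.Particles dim) (N.Particles dim) ℂ) := by
  obtain ⟨R, hR⟩ := exists_dualLocal_eq E hO
  have hR' : ∀ z : N.Particles dim × N.Particles dim,
      (fun v : {v : V // v ∉ G} => N.received v.1 (N.swapParticles U z).1) =
        fun v : {v : V // v ∉ G} => N.received v.1 z.1 := by
    intro z
    funext v e
    have : v.1 ∉ U e.1 := fun h => v.2 (hU e.1 v.1 e.2 h)
    simp [received, swapParticles_fst, this]
  have hcond : ∀ z w : N.Particles dim × N.Particles dim,
      ((∀ v ∈ G, N.received v z.1 = N.received v w.1) ∧ z.2 = w.2) →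
      (∀ v ∈ G, N.received v (N.swapParticles U z).1 = N.received v (N.swapParticles U w).1) ∧
        (N.swapParticles U z).2 = (N.swapParticles U w).2 := by
    rintro z w ⟨h1, h2⟩
    constructor
    · intro v hv
      funext e
      simp only [received, swapParticles_fst, h2]
      split_ifs
      · rfl
      · exact congrFun (h1 v hv) e
    · funext e v
      simp only [swapParticles_snd, h2]
      split_ifs with h
      · exact congrFun (h1 v.1 (hU e v.1 v.2 h)) ⟨e, v.2⟩
      · rfl
  have hiff : ∀ z w : N.Particles dim × N.Particles dim,
      ((∀ v ∈ G, N.received v (N.swapParticles U z).1 = N.received v (N.swapParticles U w).1) ∧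
        (N.swapParticles U z).2 = (N.swapParticles U w).2) ↔
      ((∀ v ∈ G, N.received v z.1 = N.received v w.1) ∧ z.2 = w.2) := by
    refine fun z w => ⟨fun h => ?_, hcond z w⟩
    simpa only [swapParticles_swapParticles_self] using hcond _ _ h
  have hF : ∀ z w, (N.dualLocal E O ⊗ₖ (1 : Matrix (N.Particles dim) (N.Particles dim) ℂ)) z w =
      if (∀ v ∈ G, N.received v z.1 = N.received v w.1) ∧ z.2 = w.2 then
        R (fun v => N.received v.1 z.1) (fun v => N.received v.1 w.1)
      else 0 := by
    intro z w
    rw [kroneckerMap_apply, hR, one_apply, ite_and]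
    split_ifs <;> simp
  ext z w
  rw [submatrix_apply, hF, hF, hR', hR']
  simp only [hiff]

/-- An observable of the first copy without support in `G` cannot detect which particles have been
exchanged at the parties in `G`. For every source, it is enough to know the exchanged particles
at the other parties, up to complementation. -/
lemma trace_kronecker_one_mul_twoCopyState_congr {O : Matrix ((v : V) → ι v) ((v : V) → ι v) ℂ}
    {G : Finset V} (hO : NoSupportIn O G) {W W' : N.Source → Finset V}
    (h : ∀ e, (∀ v ∈ N.parties e, v ∉ G → (v ∈ W e ↔ v ∈ W' e)) ∨
      (∀ v ∈ N.parties e, v ∉ G → (v ∈ W e ↔ v ∉ W' e))) :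
    ((O ⊗ₖ (1 : Matrix ((v : V) → ι v) ((v : V) → ι v) ℂ)) * twoCopyState ς E W).trace =
      ((O ⊗ₖ (1 : Matrix ((v : V) → ι v) ((v : V) → ι v) ℂ)) * twoCopyState ς E W').trace := by
  classical
  -- Complementing `W' e` where necessary makes it agree with `W e` at the parties outside `G`.
  set W'' : N.Source → Finset V := fun e =>
    if ∀ v ∈ N.parties e, v ∉ G → (v ∈ W e ↔ v ∈ W' e) then W' e else (W' e)ᶜ with hW''
  have h1 : swappedSources ς W'' = swappedSources ς W' := by
    refine swappedSources_congr ς fun e => ?_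
    by_cases he : ∀ v ∈ N.parties e, v ∉ G → (v ∈ W e ↔ v ∈ W' e)
    · left; intro v _; simp only [hW'', if_pos he]
    · right; intro v _; simp only [hW'', if_neg he, Finset.mem_compl]
  have h2 : ∀ e, ∀ v ∈ N.parties e, v ∈ symmDiff (W e) (W'' e) → v ∈ G := by
    intro e v hv hmem
    by_contra hG
    by_cases he : ∀ v ∈ N.parties e, v ∉ G → (v ∈ W e ↔ v ∈ W' e)
    · simp only [hW'', if_pos he, Finset.mem_symmDiff, he v hv hG] at hmem
      tauto
    · have := (h e).resolve_left he v hv hG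
      simp only [hW'', if_neg he, Finset.mem_symmDiff, Finset.mem_compl, this] at hmem
      tauto
  have h3 : swappedSources ς W'' = (swappedSources ς W).submatrix
      (N.swapParticles fun e => symmDiff (W e) (W'' e))
      (N.swapParticles fun e => symmDiff (W e) (W'' e)) := by
    rw [swappedSources_submatrix]
    simp only [symmDiff_symmDiff_cancel_left]
  rw [trace_kronecker_one_mul_twoCopyState, trace_kronecker_one_mul_twoCopyState, ← h1, h3]
  conv_rhs => rw [← dualLocal_kronecker_one_submatrix E hO h2]
  rw [submatrix_mul_equiv, trace_submatrix_equiv]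

variable {ς}

lemma trace_kronecker_one_mul_twoCopyState_empty (hς : ∀ e, IsDensityMatrix (ς e))
    (O : Matrix ((v : V) → ι v) ((v : V) → ι v) ℂ) :
    ((O ⊗ₖ (1 : Matrix ((v : V) → ι v) ((v : V) → ι v) ℂ)) * twoCopyState ς E fun _ => ∅).trace =
      (O * N.applyLocal E (N.sourceState ς)).trace := by
  have h : swappedSources ς (fun _ => ∅) = N.sourceState ς ⊗ₖ N.sourceState ς := by
    ext z w
    rfl
  rw [trace_kronecker_one_mul_twoCopyState, h, ← mul_kronecker_mul, trace_kronecker,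
    Matrix.one_mul, (isDensityMatrix_sourceState hς).2, mul_one, trace_mul_applyLocal]

lemma isDensityMatrix_twoCopyState (hς : ∀ e, IsDensityMatrix (ς e)) (W : N.Source → Finset V) :
    IsDensityMatrix (twoCopyState ς E W) := by
  have hX := isDensityMatrix_sourceState hς
  constructor
  · exact posSemidef_sum _ fun k _ =>
      ((hX.1.kronecker hX.1).submatrix _).mul_mul_conjTranspose_same _
  · have h := trace_kronecker_one_mul_twoCopyState ς E W 1
    rw [dualLocal_one, one_kronecker_one, one_kronecker_one, Matrix.one_mul, Matrix.one_mul] at h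
    rw [h, swappedSources, trace_submatrix_equiv, trace_kronecker, hX.2, mul_one]

lemma isDensityMatrix_applyLocal (hς : ∀ e, IsDensityMatrix (ς e)) :
    IsDensityMatrix (N.applyLocal E (N.sourceState ς)) := by
  have hX := isDensityMatrix_sourceState hς
  constructor
  · exact posSemidef_sum _ fun k _ => hX.1.mul_mul_conjTranspose_same _
  · have h := trace_mul_applyLocal E 1 (N.sourceState ς)
    rwa [dualLocal_one, Matrix.one_mul, Matrix.one_mul, hX.2] at h

end QuantumNetwork

/-! ### The two inflations of a bipartite network -/

namespace QuantumNetwork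

open scoped Kronecker

variable {V : Type*} [DecidableEq V] {N : QuantumNetwork V}

lemma IsBipartite.eq_of_notMem (hN : N.IsBipartite) {e : N.Source} {G : Finset V} {u v w : V}
    (hu : u ∈ N.parties e) (huG : u ∈ G) (hv : v ∈ N.parties e) (hvG : v ∉ G)
    (hw : w ∈ N.parties e) (hwG : w ∉ G) : v = w := by
  by_contra hvw
  refine absurd (hN e) (not_le.2 (Finset.two_lt_card.2 ⟨u, hu, v, hv, w, hw, ?_, ?_, hvw⟩))
  · rintro rfl; exact hvG huG
  · rintro rfl; exact hwG huG

/-- A bipartite source which reaches a party in `G` reaches at most one party outside `G`. -/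
lemma IsBipartite.iff_or_iff_not (hN : N.IsBipartite) {e : N.Source} {G : Finset V}
    (h : ¬ Disjoint (N.parties e) G) (W W' : Finset V) :
    (∀ v ∈ N.parties e, v ∉ G → (v ∈ W ↔ v ∈ W')) ∨
      (∀ v ∈ N.parties e, v ∉ G → (v ∈ W ↔ v ∉ W')) := by
  obtain ⟨u, hu, huG⟩ := Finset.not_disjoint_iff.1 h
  by_contra! hcon
  obtain ⟨⟨v, hv, hvG, hv'⟩, w, hw, hwG, hw'⟩ := hcon
  obtain rfl := hN.eq_of_notMem hu huG hv hvG hw hwG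
  tauto

variable [Fintype V] {ι : V → Type*} [∀ v, Fintype (ι v)] [∀ v, DecidableEq (ι v)]
  {dim : N.Source → V → ℕ}

/-- In `η`, the sources between `G₁` and `G₂` are cut. In `ξ`, the sources between `G₁` and `G₄`
serve the original of `G₁`, and those between `G₁` and `G₂` or `G₃` serve the copy of `G₁`. -/
lemma exists_inflations (hN : N.IsBipartite)
    {ς : (e : N.Source) → Matrix (N.Emitted dim e) (N.Emitted dim e) ℂ}
    (hς : ∀ e, IsDensityMatrix (ς e)) (E : (v : V) → QuantumChannel (N.Received dim v) (ι v))
    {G₁ G₂ G₃ G₄ : Finset V}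
    (hG : ∀ v, ∃! i : Fin 4, v ∈ (![G₁, G₂, G₃, G₄] : Fin 4 → Finset V) i) :
    ∃ (η : Matrix ((v : V) → ι v) ((v : V) → ι v) ℂ)
      (ξ : Matrix (WithCopy ι G₁) (WithCopy ι G₁) ℂ),
      IsDensityMatrix η ∧ IsDensityMatrix ξ ∧
      (∀ O, NoSupportIn O G₁ →
        (O * η).trace = (O * N.applyLocal E (N.sourceState ς)).trace) ∧
      (∀ O, NoSupportIn O G₂ →
        (O * η).trace = (O * N.applyLocal E (N.sourceState ς)).trace) ∧
      (∀ O, NoSupportIn O G₃ → (onOriginal G₁ O * ξ).trace = (O * η).trace) ∧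
      (∀ O, NoSupportIn O G₄ →
        (onCopy G₁ O * ξ).trace = (O * N.applyLocal E (N.sourceState ς)).trace) := by
  choose c hc hu using hG
  have m : ∀ v i, v ∈ (![G₁, G₂, G₃, G₄] : Fin 4 → Finset V) i ↔ c v = i := fun v i =>
    ⟨fun h => (hu v i h).symm, fun h => h ▸ hc v⟩
  have m1 : ∀ v, v ∈ G₁ ↔ c v = 0 := fun v => m v 0
  have m2 : ∀ v, v ∈ G₂ ↔ c v = 1 := fun v => m v 1
  have m3 : ∀ v, v ∈ G₃ ↔ c v = 2 := fun v => m v 2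
  have m4 : ∀ v, v ∈ G₄ ↔ c v = 3 := fun v => m v 3
  set Wη : N.Source → Finset V := fun e => if Disjoint (N.parties e) G₂ then ∅ else G₁ with hWη
  set Wξ : N.Source → Finset V := fun e => if Disjoint (N.parties e) G₄ then G₁ else ∅ with hWξ
  set Ξ := twoCopyState ς E Wξ with hΞ
  set ε := withCopyProdEquiv ι G₁ with hε
  refine ⟨partialTrace (twoCopyState ς E Wη), partialTrace (Ξ.submatrix ε ε),
    (isDensityMatrix_twoCopyState E hς Wη).partialTrace,
    ((isDensityMatrix_twoCopyState E hς Wξ).submatrix_equiv ε).partialTrace, ?_, ?_, ?_, ?_⟩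
  · intro O hO
    rw [trace_mul_partialTrace, ← trace_kronecker_one_mul_twoCopyState_empty E hς]
    refine trace_kronecker_one_mul_twoCopyState_congr ς E hO fun e => Or.inl fun v _ hv => ?_
    simp only [hWη]
    split_ifs <;> simp [hv]
  · intro O hO
    rw [trace_mul_partialTrace, ← trace_kronecker_one_mul_twoCopyState_empty E hς]
    refine trace_kronecker_one_mul_twoCopyState_congr ς E hO fun e => ?_
    by_cases h2 : Disjoint (N.parties e) G₂
    · left; simp [hWη, h2]
    · exact hN.iff_or_iff_not h2 _ _
  · intro O hO
    rw [trace_mul_partialTrace, trace_mul_partialTrace, onOriginal_kronecker_one,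
      submatrix_mul_equiv, trace_submatrix_equiv]
    refine trace_kronecker_one_mul_twoCopyState_congr ς E hO fun e => ?_
    by_cases h3 : Disjoint (N.parties e) G₃
    · by_cases h2 : Disjoint (N.parties e) G₂ <;> by_cases h4 : Disjoint (N.parties e) G₄
      · -- All the parties of `e` are in `G₁`, so that all its particles are exchanged.
        right
        intro v hv _
        have n2 := fun h => Finset.disjoint_left.1 h2 hv ((m2 v).2 h)
        have n3 := fun h => Finset.disjoint_left.1 h3 hv ((m3 v).2 h)
        have n4 := fun h => Finset.disjoint_left.1 h4 hv ((m4 v).2 h)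
        simp only [hWξ, hWη, if_pos h2, if_pos h4, m1, Finset.notMem_empty, not_false_eq_true,
          iff_true]
        have hall : ∀ i : Fin 4, i ≠ 1 → i ≠ 2 → i ≠ 3 → i = 0 := by decide
        exact hall _ n2 n3 n4
      · left; simp [hWξ, hWη, h2, h4]
      · left; simp [hWξ, hWη, h2, h4]
      · -- The source `e` serves `G₂` and `G₄`, and thus no party in `G₁`.
        left
        intro v hv _
        obtain ⟨u, hu, hu2⟩ := Finset.not_disjoint_iff.1 h2
        obtain ⟨w, hw, hw4⟩ := Finset.not_disjoint_iff.1 h4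
        simp only [hWξ, hWη, if_neg h2, if_neg h4, Finset.notMem_empty, false_iff]
        intro hv1
        rw [m1] at hv1
        have := hN.eq_of_notMem hu hu2 hv (by rw [m2, hv1]; decide) hw
          (by rw [m2, (m4 w).1 hw4]; decide)
        rw [← this, m4, hv1] at hw4
        exact absurd hw4 (by decide)
    · exact hN.iff_or_iff_not h3 _ _
  · intro O hO
    -- `onCopy` acts on the second copy of `G₁`; exchanging the two copies of `G₁` turns it into an
    -- observable of the first copy, and complements `Wξ e` within `G₁`.
    have hswap : Ξ = (twoCopyState ς E fun e => symmDiff (Wξ e) G₁).submatrix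
        (swapOn G₁) (swapOn G₁) := by
      rw [twoCopyState_submatrix]
      simp only [symmDiff_symmDiff_cancel_right, hΞ]
    rw [trace_mul_partialTrace, onCopy_kronecker_one, submatrix_mul_equiv, trace_submatrix_equiv,
      hswap, submatrix_mul_equiv, trace_submatrix_equiv,
      ← trace_kronecker_one_mul_twoCopyState_empty E hς]
    refine trace_kronecker_one_mul_twoCopyState_congr ς E hO fun e => ?_
    by_cases h4 : Disjoint (N.parties e) G₄
    · left; simp [hWξ, h4]
    · exact hN.iff_or_iff_not h4 _ _

end QuantumNetwork

/-! ### Stabilizer operators and the fidelity -/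

section Fidelity

lemma isHermitian_pureState {n : Type*} (ψ : n → ℂ) : (pureState ψ).IsHermitian := by
  rw [IsHermitian, pureState, conjTranspose_vecMulVec, star_star]

variable {n : Type*} [Fintype n]

lemma pureFidelity_eq (ψ : n → ℂ) (ρ : Matrix n n ℂ) :
    pureFidelity ψ ρ = (pureState ψ * ρ).trace.re := by
  rw [pureFidelity, pureState, vecMulVec_mul, trace_vecMulVec, dotProduct_mulVec, dotProduct_comm]

lemma pureState_mul_self {ψ : n → ℂ} (hψ : star ψ ⬝ᵥ ψ = 1) :
    pureState ψ * pureState ψ = pureState ψ := by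
  rw [pureState, vecMulVec_mul_vecMulVec, hψ]
  simp

lemma mul_pureState {S : Matrix n n ℂ} {ψ : n → ℂ} (h : S *ᵥ ψ = ψ) :
    S * pureState ψ = pureState ψ := by
  rw [pureState, mul_vecMulVec, h]

lemma pureState_mul {S : Matrix n n ℂ} {ψ : n → ℂ} (h : Sᴴ *ᵥ ψ = ψ) :
    pureState ψ * S = pureState ψ := by
  rw [pureState, vecMulVec_mul, ← conjTranspose_conjTranspose S, ← star_mulVec, h]

variable [DecidableEq n]

lemma pureFidelity_le_re_trace {ψ : n → ℂ} (hψ : star ψ ⬝ᵥ ψ = 1) {P ρ : Matrix n n ℂ}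
    (hP : P.IsHermitian) (hP' : P * P = P) (h : P *ᵥ ψ = ψ) (hρ : IsDensityMatrix ρ) :
    pureFidelity ψ ρ ≤ (P * ρ).trace.re := by
  have e : (P - pureState ψ)ᴴ * (P - pureState ψ) = P - pureState ψ := by
    rw [conjTranspose_sub, hP.eq, (isHermitian_pureState ψ).eq, Matrix.mul_sub, Matrix.sub_mul,
      Matrix.sub_mul, hP', mul_pureState h, pureState_mul (hP.eq.symm ▸ h), pureState_mul_self hψ]
    abel
  have := re_trace_mul_nonneg (posSemidef_conjTranspose_mul_self (P - pureState ψ)) hρ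
  rw [e, Matrix.sub_mul, Matrix.trace_sub, Complex.sub_re, ← pureFidelity_eq] at this
  linarith

lemma pureFidelity_le_one {ψ : n → ℂ} (hψ : star ψ ⬝ᵥ ψ = 1) {ρ : Matrix n n ℂ}
    (hρ : IsDensityMatrix ρ) : pureFidelity ψ ρ ≤ 1 := by
  have := pureFidelity_le_re_trace hψ isHermitian_one (Matrix.one_mul 1) (one_mulVec ψ) hρ
  rwa [Matrix.one_mul, hρ.2, Complex.one_re] at this

/-- If the expectations of two contractions in a state `ρ` are at least `4 f - 3` and `2 f - 1`,
then `f` is bounded in terms of the expectation of their anticommutator. -/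
lemma le_of_expectation_le {A B ρ : Matrix n n ℂ} (hA : IsContraction A) (hB : IsContraction B)
    (hρ : IsDensityMatrix ρ) {f Λ : ℝ} (hfA : 4 * f - 3 ≤ (A * ρ).trace.re)
    (hfB : 2 * f - 1 ≤ (B * ρ).trace.re) (hΛ : ‖(anticommutator A Bᴴ * ρ).trace‖ ≤ Λ) :
    f ≤ (7 + √(4 + 5 * Λ / 2)) / 10 := by
  have hΛ0 : 0 ≤ Λ := (norm_nonneg _).trans hΛ
  set X := (A * ρ).trace.re with hX
  set Y := (B * ρ).trace.re with hY
  set t := (anticommutator A Bᴴ * ρ).trace.re with ht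
  have hsq := sq_sq_add_sq_le hA hB hρ hX hY
  have htΛ : |t| ≤ Λ := (Complex.abs_re_le_norm _).trans hΛ
  rw [le_div_iff₀ (by norm_num)]
  rcases le_or_gt f (9 / 10) with hf | hf
  · -- The right-hand side is at least `9 / 10`.
    have : (2 : ℝ) ≤ √(4 + 5 * Λ / 2) := Real.le_sqrt_of_sq_le (by linarith)
    linarith
  · have hX2 : (4 * f - 3) ^ 2 ≤ X ^ 2 := pow_le_pow_left₀ (by linarith) hfA 2
    have hY2 : (2 * f - 1) ^ 2 ≤ Y ^ 2 := pow_le_pow_left₀ (by linarith) hfB 2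
    have hpos : 0 < X ^ 2 + Y ^ 2 := by nlinarith
    have hXY : X * Y * t ≤ (X ^ 2 + Y ^ 2) * (Λ / 2) := by
      have h0 : 0 ≤ X * Y := mul_nonneg (by linarith) (by linarith)
      calc X * Y * t ≤ X * Y * Λ := mul_le_mul_of_nonneg_left ((le_abs_self t).trans htΛ) h0
        _ ≤ _ := by nlinarith [sq_nonneg (X - Y)]
    have hs : X ^ 2 + Y ^ 2 ≤ 1 + Λ / 2 := by
      refine le_of_mul_le_mul_left ?_ hpos
      nlinarith
    have : 10 * f - 7 ≤ √(4 + 5 * Λ / 2) := Real.le_sqrt_of_sq_le (by nlinarith)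
    linarith

end Fidelity

section Stabilizer

open Polynomial

variable {V : Type*} [Fintype V] [DecidableEq V] {ι : V → Type*} [∀ v, Fintype (ι v)]
  [∀ v, DecidableEq (ι v)]

/-- The projection onto the fixed vectors of a stabilizer operator has no support where the operator
has none, and it is a function of the operator. -/
lemma exists_stabilizer_projection {ψ : ((v : V) → ι v) → ℂ}
    {S : Matrix ((v : V) → ι v) ((v : V) → ι v) ℂ} (hS : IsUnitaryOrProjection S)
    (hψ : S *ᵥ ψ = ψ) {G : Finset V} (hG : NoSupportIn S G) :
    ∃ p : ℂ[X], (aeval S p).IsHermitian ∧ aeval S p * aeval S p = aeval S p ∧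
      S * aeval S p = aeval S p ∧ aeval S p *ᵥ ψ = ψ ∧ NoSupportIn (aeval S p) G := by
  obtain ⟨p, hp, hp', hp1⟩ := exists_aeval_eq_fixedProjection hS.isStarNormal
  refine ⟨p, hp, ?_, hp', ?_, hG.aeval p⟩
  · rw [aeval_mul_of_mul_eq hp', hp1, one_smul]
  · rw [aeval_mulVec_of_mulVec_eq hψ, hp1, one_smul]

end Stabilizer

section SinglePreparation

variable {V : Type*} [Fintype V] [DecidableEq V] {ι : V → Type*} [∀ v, Fintype (ι v)]
  [∀ v, DecidableEq (ι v)]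

/-- For a state `ρ` prepared without shared randomness, the inflation `ξ` stabilizes approximately
both `S₃` on the original parties and `S₄` on the parties with the copy of `G₁`. The bound for `S₃`
is inherited from `η`, where both `S₁` and `S₂` are approximately stabilized. -/
lemma QuantumNetwork.exists_inflation_expectation_le {ψ : ((v : V) → ι v) → ℂ}
    (hψ : star ψ ⬝ᵥ ψ = 1) {S₁ S₂ S₄ : Matrix ((v : V) → ι v) ((v : V) → ι v) ℂ}
    (hS₁ : IsUnitaryOrProjection S₁) (hS₂ : IsUnitaryOrProjection S₂)
    (hS₄ : IsUnitaryOrProjection S₄) (hcomm : Commute S₁ S₂)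
    (hstab₁ : S₁ *ᵥ ψ = ψ) (hstab₂ : S₂ *ᵥ ψ = ψ) (hstab₄ : S₄ *ᵥ ψ = ψ)
    {G₁ G₂ G₃ G₄ : Finset V}
    (hG : ∀ v, ∃! i : Fin 4, v ∈ (![G₁, G₂, G₃, G₄] : Fin 4 → Finset V) i)
    (hG₁ : NoSupportIn S₁ G₁) (hG₂ : NoSupportIn S₂ G₂)
    (hG₃ : NoSupportIn (S₁ * S₂) G₃) (hG₄ : NoSupportIn S₄ G₄)
    {N : QuantumNetwork V} (hN : N.IsBipartite) {dim : N.Source → V → ℕ}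
    {ς : (e : N.Source) → Matrix (N.Emitted dim e) (N.Emitted dim e) ℂ}
    (hς : ∀ e, IsDensityMatrix (ς e)) (E : (v : V) → QuantumChannel (N.Received dim v) (ι v)) :
    ∃ ξ : Matrix (WithCopy ι G₁) (WithCopy ι G₁) ℂ, IsDensityMatrix ξ ∧
      4 * pureFidelity ψ (N.applyLocal E (N.sourceState ς)) - 3 ≤
        (onOriginal G₁ (S₁ * S₂) * ξ).trace.re ∧
      2 * pureFidelity ψ (N.applyLocal E (N.sourceState ς)) - 1 ≤
        (onCopy G₁ S₄ * ξ).trace.re := by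
  obtain ⟨η, ξ, hη, hξ, h1, h2, h3, h4⟩ := exists_inflations hN hς E hG
  have hρ := isDensityMatrix_applyLocal E hς
  set ρ := N.applyLocal E (N.sourceState ς)
  refine ⟨ξ, hξ, ?_, ?_⟩
  · obtain ⟨p, hP, hPP, hSP, hPψ, hPG⟩ := exists_stabilizer_projection hS₁ hstab₁ hG₁
    obtain ⟨q, hQ, hQQ, hSQ, hQψ, hQG⟩ := exists_stabilizer_projection hS₂ hstab₂ hG₂
    have cPQ := hcomm.aeval_aeval p q
    have cSQ : Commute S₁ (Polynomial.aeval S₂ q) := by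
      simpa using hcomm.aeval_aeval Polynomial.X q
    have cSP : Commute (Polynomial.aeval S₁ p) S₂ := by
      simpa using hcomm.aeval_aeval p Polynomial.X
    have cP : Commute (Polynomial.aeval S₁ p) S₁ := by
      simpa using (Commute.refl S₁).aeval_aeval p Polynomial.X
    have cQ : Commute (Polynomial.aeval S₂ q) S₂ := by
      simpa using (Commute.refl S₂).aeval_aeval q Polynomial.X
    set P := Polynomial.aeval S₁ p
    set Q := Polynomial.aeval S₂ q
    have hf1 := pureFidelity_le_re_trace hψ hP hPP hPψ hρ
    have hf2 := pureFidelity_le_re_trace hψ hQ hQQ hQψ hρ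
    rw [← h1 P hPG] at hf1
    rw [← h2 Q hQG] at hf2
    have hu := re_trace_mul_add_le hP hPP hQ hQQ cPQ.eq hη
    have hPQ : (P * Q).IsHermitian := by
      rw [IsHermitian, conjTranspose_mul, hP.eq, hQ.eq, cPQ.eq]
    have hPQ' : P * Q * (P * Q) = P * Q := by
      calc P * Q * (P * Q) = P * (Q * P) * Q := by noncomm_ring
        _ = (P * P) * (Q * Q) := by rw [← cPQ.eq]; noncomm_ring
        _ = _ := by rw [hPP, hQQ]
    have hl : S₁ * S₂ * (P * Q) = P * Q := by
      calc S₁ * S₂ * (P * Q) = S₁ * (S₂ * P) * Q := by noncomm_ring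
        _ = (S₁ * P) * (S₂ * Q) := by rw [← cSP.eq]; noncomm_ring
        _ = _ := by rw [hSP, hSQ]
    have hr : P * Q * (S₁ * S₂) = P * Q := by
      calc P * Q * (S₁ * S₂) = P * (Q * S₁) * S₂ := by noncomm_ring
        _ = (P * S₁) * (Q * S₂) := by rw [← cSQ.eq]; noncomm_ring
        _ = _ := by rw [cP.eq, cQ.eq, hSP, hSQ]
    have hfin := two_mul_sub_one_le_re_trace
      (hS₁.isContraction.mul hS₂.isContraction).posSemidef hPQ hPQ' hl hr hη
    rw [h3 _ hG₃]
    linarith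
  · have hfin := two_mul_sub_one_le_re_trace hS₄.isContraction.posSemidef
      (isHermitian_pureState ψ) (pureState_mul_self hψ) (mul_pureState hstab₄)
      (pureState_mul (hS₄.conjTranspose_mulVec hstab₄)) hρ
    rw [h4 _ hG₄]
    rwa [← pureFidelity_eq] at hfin

end SinglePreparation

/-! ### Shared randomness -/

lemma hasSum_pureFidelity {n : Type*} [Fintype n] (ψ : n → ℂ) {L : Type*} {p : L → ℝ}
    {σ : L → Matrix n n ℂ} {ρ : Matrix n n ℂ}
    (h : ∀ i j, HasSum (fun l => (p l : ℂ) * σ l i j) (ρ i j)) :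
    HasSum (fun l => p l * pureFidelity ψ (σ l)) (pureFidelity ψ ρ) := by
  have h1 : HasSum (fun l => ∑ i, ∑ j, star (ψ i) * ((p l : ℂ) * σ l i j * ψ j))
      (∑ i, ∑ j, star (ψ i) * (ρ i j * ψ j)) :=
    hasSum_sum fun i _ => hasSum_sum fun j _ => ((h i j).mul_right _).mul_left _
  convert Complex.reCLM.hasSum h1 using 1
  · funext l
    simp only [Complex.reCLM_apply]
    rw [pureFidelity, ← Complex.re_ofReal_mul]
    simp only [dotProduct, mulVec, Pi.star_apply, Finset.mul_sum]
    refine congrArg Complex.re (Finset.sum_congr rfl fun i _ => Finset.sum_congr rfl fun j _ => ?_)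
    ring
  · simp only [Complex.reCLM_apply, pureFidelity, dotProduct, mulVec, Pi.star_apply,
      Finset.mul_sum]

end

theorem mainTheorem2 {V : Type*} [Fintype V] [DecidableEq V]
    {ι : V → Type*} [∀ v, Fintype (ι v)] [∀ v, DecidableEq (ι v)]
    (ψ : ((v : V) → ι v) → ℂ) (hψ : star ψ ⬝ᵥ ψ = 1)
    (S₁ S₂ S₃ S₄ : Matrix ((v : V) → ι v) ((v : V) → ι v) ℂ)
    (hS₁ : IsUnitaryOrProjection S₁) (hS₂ : IsUnitaryOrProjection S₂)
    (hS₄ : IsUnitaryOrProjection S₄)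
    (hcomm : Commute S₁ S₂) (hS₃ : S₃ = S₁ * S₂)
    (hstab₁ : S₁ *ᵥ ψ = ψ) (hstab₂ : S₂ *ᵥ ψ = ψ) (hstab₄ : S₄ *ᵥ ψ = ψ)
    (G₁ G₂ G₃ G₄ : Finset V)
    (hG : ∀ v, ∃! i : Fin 4, v ∈ (![G₁, G₂, G₃, G₄] : Fin 4 → Finset V) i)
    (hG₁ : NoSupportIn S₁ G₁) (hG₂ : NoSupportIn S₂ G₂)
    (hG₃ : NoSupportIn S₃ G₃) (hG₄ : NoSupportIn S₄ G₄)
    (hno : ∀ φ : WithCopy ι G₁ → ℂ,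
      onOriginal G₁ S₃ *ᵥ φ = φ → onCopy G₁ S₄ *ᵥ φ = φ → φ = 0)
    (N : QuantumNetwork V) (hN : N.IsBipartite) :
    ¬ N.CanPrepare (pureState ψ) ∧
    ∀ ρ : Matrix ((v : V) → ι v) ((v : V) → ι v) ℂ, N.CanPrepare ρ →
      pureFidelity ψ ρ ≤
        (7 + Real.sqrt (4 + 5 *
          maxAbsExpectation (anticommutator (onOriginal G₁ S₃) (onCopy G₁ S₄)ᴴ) / 2)) / 10 ∧
      (IsStarNormal (anticommutator (onOriginal G₁ S₃) (onCopy G₁ S₄)ᴴ) →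
        pureFidelity ψ ρ ≤
          (7 + Real.sqrt (4 + 5 *
            maxAbsEigenvalue (anticommutator (onOriginal G₁ S₃) (onCopy G₁ S₄)ᴴ) / 2)) / 10) := by
  subst hS₃
  have hA : IsContraction (onOriginal G₁ (S₁ * S₂)) :=
    (hS₁.isContraction.mul hS₂.isContraction).onOriginal G₁
  have hB : IsContraction (onCopy G₁ S₄) := hS₄.isContraction.onCopy G₁
  constructor
  · rintro ⟨dim, ς, L, p, E, hς, hp, hp1, hsum⟩
    have hfid : pureFidelity ψ (pureState ψ) = 1 := by
      rw [pureFidelity_eq, pureState_mul_self hψ, pureState, trace_vecMulVec, dotProduct_comm, hψ,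
        Complex.one_re]
    have hf := hasSum_pureFidelity ψ hsum
    rw [hfid] at hf
    -- The fidelities are at most `1` and their average is `1`, so one of them is equal to `1`.
    have hz : HasSum (fun l => p l * (1 - pureFidelity ψ (N.applyLocal (E l) (N.sourceState ς))))
        0 := by
      simpa [mul_sub] using hp1.sub hf
    have hle : ∀ l, pureFidelity ψ (N.applyLocal (E l) (N.sourceState ς)) ≤ 1 := fun l =>
      pureFidelity_le_one hψ (QuantumNetwork.isDensityMatrix_applyLocal (E l) hς)
    have hz' := (hasSum_zero_iff_of_nonneg fun l =>
      mul_nonneg (hp l) (sub_nonneg.2 (hle l))).1 hz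
    obtain ⟨l, hl⟩ : ∃ l, p l ≠ 0 := by
      by_contra! h
      have : p = 0 := funext h
      rw [this] at hp1
      exact zero_ne_one (hasSum_zero.unique hp1)
    have hl1 : pureFidelity ψ (N.applyLocal (E l) (N.sourceState ς)) = 1 := by
      have := (mul_eq_zero.1 (congrFun hz' l)).resolve_left hl
      linarith
    obtain ⟨ξ, hξ, h3, h4⟩ := QuantumNetwork.exists_inflation_expectation_le hψ hS₁ hS₂ hS₄ hcomm
      hstab₁ hstab₂ hstab₄ hG hG₁ hG₂ hG₃ hG₄ hN hς (E l)
    rw [hl1] at h3 h4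
    obtain ⟨φ, hφ, hφ3, hφ4⟩ := exists_common_fixed_vector hA hB hξ (by linarith) (by linarith)
    exact hφ (hno φ hφ3 hφ4)
  · rintro ρ ⟨dim, ς, L, p, E, hς, hp, hp1, hsum⟩
    have hf := hasSum_pureFidelity ψ hsum
    have key : ∀ Λ, maxAbsExpectation
        (anticommutator (onOriginal G₁ (S₁ * S₂)) (onCopy G₁ S₄)ᴴ) ≤ Λ →
        pureFidelity ψ ρ ≤ (7 + √(4 + 5 * Λ / 2)) / 10 := by
      intro Λ hΛ
      have hl : ∀ l, pureFidelity ψ (N.applyLocal (E l) (N.sourceState ς)) ≤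
          (7 + √(4 + 5 * Λ / 2)) / 10 := by
        intro l
        obtain ⟨ξ, hξ, h3, h4⟩ := QuantumNetwork.exists_inflation_expectation_le hψ hS₁ hS₂ hS₄
          hcomm hstab₁ hstab₂ hstab₄ hG hG₁ hG₂ hG₃ hG₄ hN hς (E l)
        exact le_of_expectation_le hA hB hξ h3 h4
          ((norm_trace_mul_le_maxAbsExpectation _ hξ).trans hΛ)
      have := hasSum_le (fun l => mul_le_mul_of_nonneg_left (hl l) (hp l)) hf
        (hp1.mul_right ((7 + √(4 + 5 * Λ / 2)) / 10))
      rwa [one_mul] at this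
    refine ⟨key _ le_rfl, fun hT => key _ ?_⟩
    have : Nonempty ((v : V) → ι v) := by
      by_contra h
      rw [not_nonempty_iff] at h
      simp [dotProduct] at hψ
    have : Nonempty (WithCopy ι G₁) := this.elim fun i => ⟨(i, fun v => i v.1)⟩
    exact maxAbsExpectation_le_maxAbsEigenvalue _
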